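/- Let $d\ge 0$ and let $\mu,\nu$ be Borel probability measures on $\mathbb R^d$ with finite second moments. Suppose that $\mu$ and $\nu$ have unnormalized Lebesgue densities $p,q:\mathbb R^d\to[0,\infty)$, i.e. $p,q$ are measurable and $\mu(dx)=Z_p^{-1}p(x)\,dx$, $\nu(dx)=Z_q^{-1}q(x)\,dx$ for some constants $Z_p,Z_q\in(0,\infty)$, and that for Lebesgue-almost every $x$, $p(x)=0$ implies $q(x)=0$ (equivalently $\nu\ll\mu$). Let $T$ be a Monge map from $\mu$ to $\nu$, that is, a minimizer of $\int|x-S(x)|^2\,\mu(dx)$ over all measurable $S:\mathbb R^d\to\mathbb R^d$ with $S_\#\mu=\nu$. Let $X^1,X^2,\dots$ be independent random variables on a probability space, each with law $\mu$, and define \[ \mu^n:=\frac1n\sum_{i=1}^n\delta_{X^i},\qquad w_i:=\frac{q(X^i)}{p(X^i)},\qquad w_i^n:=\frac{w_i}{\sum_{j=1}^n w_j},\qquad \nu^n:=\sum_{i=1}^n w_i^n\,\delta_{X^i} \] (the last two whenever $\sum_{j=1}^n w_j>0$, which almost surely holds for all large $n$). Whenever $\sum_{j=1}^n w_j>0$,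 let $\gamma^n$ be any optimal $W_2$-transport plan of $\mu^n$ and $\nu^n$, i.e. a coupling of $\mu^n$ and $\nu^n$ with \[ \int|x-y|^2\,\gamma^n(dx,dy)=\inf_{\gamma\in\Gamma(\mu^n,\nu^n)}\int|x-y|^2\,\gamma(dx,dy), \] where $\Gamma(\mu^n,\nu^n)$ is the set of probability measures on $\mathbb R^d\times\mathbb R^d$ with marginals $\mu^n$ and $\nu^n$, and let $T^n(x):=\int y\,\gamma^n(x,dy)$ be its barycentric projection, where $\gamma^n(x,dy)$ is the conditional distribution of the second coordinate given that the first one equals $x$ (for the finitely many other $n$, $\gamma^n$ is an arbitrary probability measure on $\mathbb R^d\times\mathbb R^d$). Then, almost surely, for every such choice of the plans $\gamma^n$, as $n\to\infty$, \[ T^n_\#\mu^n\to T_\#\mu=\nu\quad\text{weakly},\qquad\text{and}\qquad \limsup_{n\to\infty}\|T^n\|_{L^2(\mu^n)}\le\|T\|_{L^2(\mu)}. \] -/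

import Mathlib

open MeasureTheory ProbabilityTheory Filter
open scoped Topology ENNReal BoundedContinuousFunction

namespace ImportanceTransport

noncomputable section

/-- The Euclidean space `ℝ^d`. -/
abbrev Rd (d : ℕ) : Type := EuclideanSpace ℝ (Fin d)

variable {d : ℕ}

/-- `p ≥ 0` is an unnormalized Lebesgue density of `μ`: `p(x) dx = Z • μ(dx)` for some constant
`0 < Z < ∞`. -/
def IsUnnormalizedDensity (p : Rd d → ℝ) (μ : Measure (Rd d)) : Prop :=
  Measurable p ∧ (∀ x, 0 ≤ p x) ∧
    ∃ Z : ℝ, 0 < Z ∧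
      (volume : Measure (Rd d)).withDensity (fun x => ENNReal.ofReal (p x)) = ENNReal.ofReal Z • μ

/-- `T` is a minimizer of the quadratic Monge problem
`inf {∫ |x - T x|² dμ : T measurable, T_# μ = ν}`. -/
def IsMongeMap (μ ν : Measure (Rd d)) (T : Rd d → Rd d) : Prop :=
  Measurable T ∧ μ.map T = ν ∧
    ∀ S : Rd d → Rd d, Measurable S → μ.map S = ν →
      ∫⁻ x, ‖x - T x‖ₑ ^ 2 ∂μ ≤ ∫⁻ x, ‖x - S x‖ₑ ^ 2 ∂μ

/-- The transport plans (couplings) of `μ` and `ν`. -/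
def couplings (μ ν : Measure (Rd d)) : Set (ProbabilityMeasure (Rd d × Rd d)) :=
  {γ | (γ : Measure (Rd d × Rd d)).map Prod.fst = μ ∧ (γ : Measure (Rd d × Rd d)).map Prod.snd = ν}

/-- The quadratic transport cost `∫ |x - y|² γ(dx, dy)`, with values in `[0, ∞]`. -/
def quadraticCost (γ : ProbabilityMeasure (Rd d × Rd d)) : ℝ≥0∞ :=
  ∫⁻ z, ‖z.1 - z.2‖ₑ ^ 2 ∂(γ : Measure (Rd d × Rd d))

/-- `γ` is an optimal `W₂`-transport plan of `μ` and `ν`. -/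
def IsOptimalPlan (μ ν : Measure (Rd d)) (γ : ProbabilityMeasure (Rd d × Rd d)) : Prop :=
  γ ∈ couplings μ ν ∧ quadraticCost γ = ⨅ γ' ∈ couplings μ ν, quadraticCost γ'

/-- The barycentric projection `x ↦ ∫ y γ(x, dy)`, where `γ(x, dy)` is the conditional law of the
second coordinate given the first one. -/
def barycentricProjection (γ : ProbabilityMeasure (Rd d × Rd d)) (x : Rd d) : Rd d :=
  ∫ y, y ∂((γ : Measure (Rd d × Rd d)).condKernel x)

/-- The empirical measure `(1/n) ∑_{i < n} δ_{x i}`. -/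
def empiricalMeasure (n : ℕ) (x : ℕ → Rd d) : Measure (Rd d) :=
  (n : ℝ≥0∞)⁻¹ • ∑ i ∈ Finset.range n, Measure.dirac (x i)

/-- The unnormalized importance weight `q(x) / p(x)`. -/
def importanceWeight (p q : Rd d → ℝ) (x : Rd d) : ℝ := q x / p x

/-- The sum of the unnormalized importance weights of the first `n` points. -/
def totalWeight (p q : Rd d → ℝ) (n : ℕ) (x : ℕ → Rd d) : ℝ :=
  ∑ j ∈ Finset.range n, importanceWeight p q (x j)

/-- The self-normalized importance sampling measure `∑_{i < n} (w_i / ∑_{j < n} w_j) δ_{x i}`,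
`w_i = q(x i) / p(x i)`; it is meaningful when the total weight is positive. -/
def importanceMeasure (p q : Rd d → ℝ) (n : ℕ) (x : ℕ → Rd d) : Measure (Rd d) :=
  ∑ i ∈ Finset.range n,
    ENNReal.ofReal (importanceWeight p q (x i) / totalWeight p q n x) • Measure.dirac (x i)

/-- Weak convergence: convergence of the integrals of all bounded continuous functions. -/
def WeaklyConverges (μs : ℕ → Measure (Rd d)) (μ : Measure (Rd d)) : Prop :=
  ∀ f : Rd d →ᵇ ℝ, Tendsto (fun n => ∫ x, f x ∂(μs n)) atTop (𝓝 (∫ x, f x ∂μ))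

end

end ImportanceTransport

namespace ImportanceTransport

section ConvexAnalysis

open scoped RealInnerProductSpace

variable {E : Type*} [NormedAddCommGroup E] [InnerProductSpace ℝ E]

/-- A set `G ⊆ E × E` is cyclically monotone if
`∑_{i ≤ k} ⟨y_i, x_{i+1} - x_i⟩ ≤ 0` (cyclic indices) for all points `(x_i, y_i)` of `G`. -/
def IsCyclicallyMonotone (G : Set (E × E)) : Prop :=
  ∀ (k : ℕ) (z : ℕ → E × E), (∀ i, z i ∈ G) →
    ∑ i ∈ Finset.range k, ⟪(z i).2, (z (i + 1)).1 - (z i).1⟫ + ⟪(z k).2, (z 0).1 - (z k).1⟫ ≤ 0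

/-- `y` is a subgradient of `φ` at `x`, relative to the set `D`. -/
def IsSubgradientOn (D : Set E) (φ : E → ℝ) (x y : E) : Prop :=
  x ∈ D ∧ ∀ z ∈ D, φ x + ⟪y, z - x⟫ ≤ φ z

/-- The values at `x` of the affine functions in Rockafellar's construction with base point `z₀`. -/
def rockafellarValues (G : Set (E × E)) (z₀ : E × E) (x : E) : Set ℝ :=
  {c | ∃ (k : ℕ) (z : ℕ → E × E), (∀ i, z i ∈ G) ∧ z 0 = z₀ ∧
    c = ∑ i ∈ Finset.range k, ⟪(z i).2, (z (i + 1)).1 - (z i).1⟫ + ⟪(z k).2, x - (z k).1⟫}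

lemma rockafellarValues_extend {G : Set (E × E)} {z₀ w : E × E} (hw : w ∈ G) {c : ℝ}
    (hc : c ∈ rockafellarValues G z₀ w.1) (x : E) :
    c + ⟪w.2, x - w.1⟫ ∈ rockafellarValues G z₀ x := by
  obtain ⟨k, z, hz, h0, rfl⟩ := hc
  refine ⟨k + 1, fun i => if i ≤ k then z i else w, ?_, by simp [h0], ?_⟩
  · intro i
    by_cases h : i ≤ k
    · simpa [h] using hz i
    · simpa [h] using hw
  · rw [Finset.sum_range_succ]
    have : ∀ i ∈ Finset.range k, ⟪(if i ≤ k then z i else w).2,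
        (if i + 1 ≤ k then z (i + 1) else w).1 - (if i ≤ k then z i else w).1⟫
        = ⟪(z i).2, (z (i + 1)).1 - (z i).1⟫ := by
      intro i hi
      have h := Finset.mem_range.1 hi
      rw [if_pos h.le, if_pos (by omega)]
    rw [Finset.sum_congr rfl this]
    simp

/-- Rockafellar's theorem: a nonempty cyclically monotone set is contained in the subdifferential
of a convex function. -/
theorem IsCyclicallyMonotone.exists_potential [MeasurableSpace E] [BorelSpace E]
    {G : Set (E × E)} (hG : IsCyclicallyMonotone G) (hne : G.Nonempty) :
    ∃ (D : Set E) (φ : E → ℝ), MeasurableSet D ∧ Measurable φ ∧ ConvexOn ℝ D φ ∧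
      ∀ z ∈ G, IsSubgradientOn D φ z.1 z.2 := by
  obtain ⟨z₀, hz₀⟩ := hne
  set V := rockafellarValues G z₀ with hV
  set F : E → EReal := fun x => ⨆ (k : ℕ) (z : {z : ℕ → E × E // (∀ i, z i ∈ G) ∧ z 0 = z₀}),
    ((∑ i ∈ Finset.range k, ⟪(z.1 i).2, (z.1 (i + 1)).1 - (z.1 i).1⟫
      + ⟪(z.1 k).2, x - (z.1 k).1⟫ : ℝ) : EReal) with hF
  have hlsc : LowerSemicontinuous F := by
    refine lowerSemicontinuous_iSup fun k => lowerSemicontinuous_iSup fun z => ?_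
    refine Continuous.lowerSemicontinuous (continuous_coe_real_ereal.comp ?_)
    fun_prop
  have hFm : Measurable F := hlsc.measurable
  have hle : ∀ {x c}, c ∈ V x → (c : EReal) ≤ F x := by
    rintro x c ⟨k, z, hz, h0, rfl⟩
    exact le_iSup_of_le k (le_iSup_of_le ⟨z, hz, h0⟩ le_rfl)
  have hub : ∀ {x : E} {b : EReal}, (∀ c ∈ V x, (c : EReal) ≤ b) → F x ≤ b := by
    intro x b h
    exact iSup_le fun k => iSup_le fun z => h _ ⟨k, z.1, z.2.1, z.2.2, rfl⟩
  have hVne : ∀ x, ⟪z₀.2, x - z₀.1⟫ ∈ V x := fun x =>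
    ⟨0, fun _ => z₀, fun _ => hz₀, rfl, by simp⟩
  have hbot : ∀ x, F x ≠ ⊥ := fun x h => by
    have := hle (hVne x)
    rw [h, le_bot_iff] at this
    exact EReal.coe_ne_bot _ this
  have hcoe : ∀ {x}, F x ≠ ⊤ → ((F x).toReal : EReal) = F x := fun h =>
    EReal.coe_toReal h (hbot _)
  have hle' : ∀ {x c}, F x ≠ ⊤ → c ∈ V x → c ≤ (F x).toReal := by
    intro x c h hc
    have := hle hc
    rw [← hcoe h] at this
    exact_mod_cast this
  have hub' : ∀ {x : E} {b : ℝ}, (∀ c ∈ V x, c ≤ b) → F x ≠ ⊤ ∧ (F x).toReal ≤ b := by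
    intro x b h
    have h1 : F x ≤ (b : EReal) := hub fun c hc => by exact_mod_cast h c hc
    have h2 : F x ≠ ⊤ := fun h => by
      rw [h, top_le_iff] at h1
      exact EReal.coe_ne_top _ h1
    refine ⟨h2, ?_⟩
    rw [← hcoe h2] at h1
    exact_mod_cast h1
  have hconv : ∀ ⦃x⦄, F x ≠ ⊤ → ∀ ⦃y⦄, F y ≠ ⊤ → ∀ ⦃a b : ℝ⦄, 0 ≤ a → 0 ≤ b → a + b = 1 →
      F (a • x + b • y) ≠ ⊤ ∧
        (F (a • x + b • y)).toReal ≤ a * (F x).toReal + b * (F y).toReal := by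
    intro x hx y hy a b ha hb hab
    refine hub' ?_
    rintro c ⟨k, z, hz, h0, rfl⟩
    have h1 := mul_le_mul_of_nonneg_left (hle' hx ⟨k, z, hz, h0, rfl⟩) ha
    have h2 := mul_le_mul_of_nonneg_left (hle' hy ⟨k, z, hz, h0, rfl⟩) hb
    refine le_trans (le_of_eq ?_) (add_le_add h1 h2)
    have : a • x + b • y - (z k).1 = a • (x - (z k).1) + b • (y - (z k).1) := by
      rw [smul_sub, smul_sub]
      nth_rewrite 1 [← one_smul ℝ (z k).1]
      rw [← hab, add_smul]
      abel
    rw [this, inner_add_right, inner_smul_right, inner_smul_right]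
    linear_combination (-1 : ℝ) * (∑ i ∈ Finset.range k, ⟪(z i).2, (z (i + 1)).1 - (z i).1⟫) * hab
  refine ⟨{x | F x ≠ ⊤}, fun x => (F x).toReal, ?_, measurable_ereal_toReal.comp hFm,
    ⟨fun x hx y hy a b ha hb hab => (hconv hx hy ha hb hab).1,
      fun x hx y hy a b ha hb hab => (hconv hx hy ha hb hab).2⟩, ?_⟩
  · exact hFm (measurableSet_singleton _).compl
  · intro w hw
    have hwD : F w.1 ≠ ⊤ := by
      refine (hub' (b := -⟪w.2, z₀.1 - w.1⟫) ?_).1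
      intro c hc
      obtain ⟨k, z, hz, h0, h⟩ := rockafellarValues_extend hw hc z₀.1
      have := hG k z hz
      rw [h0] at this
      linarith
    refine ⟨hwD, fun x hx => ?_⟩
    have : (F w.1).toReal ≤ (F x).toReal - ⟪w.2, x - w.1⟫ := by
      refine (hub' ?_).2
      intro c hc
      have := hle' hx (rockafellarValues_extend hw hc x)
      linarith
    linarith

/-- Legendre duality: a function `φ` on a nonempty set `D` has a conjugate `ψ`, with equality in
the Young inequality exactly at subgradients. -/
theorem exists_conjugate [MeasurableSpace E] [BorelSpace E] (D : Set E) (φ : E → ℝ)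
    (hD : D.Nonempty) :
    ∃ (D' : Set E) (ψ : E → ℝ), MeasurableSet D' ∧ Measurable ψ ∧
      (∀ x ∈ D, ∀ y ∈ D', ⟪x, y⟫ ≤ φ x + ψ y) ∧
      ∀ x y, IsSubgradientOn D φ x y → y ∈ D' ∧ φ x + ψ y = ⟪x, y⟫ := by
  obtain ⟨x₀, hx₀⟩ := hD
  set F : E → EReal := fun y => ⨆ x : D, ((⟪x.1, y⟫ - φ x.1 : ℝ) : EReal) with hF
  have hlsc : LowerSemicontinuous F := by
    refine lowerSemicontinuous_iSup fun x => ?_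
    refine Continuous.lowerSemicontinuous (continuous_coe_real_ereal.comp ?_)
    fun_prop
  have hFm : Measurable F := hlsc.measurable
  have hle : ∀ x ∈ D, ∀ y, ((⟪x, y⟫ - φ x : ℝ) : EReal) ≤ F y := fun x hx y =>
    le_iSup (fun x : D => ((⟪x.1, y⟫ - φ x.1 : ℝ) : EReal)) ⟨x, hx⟩
  have hbot : ∀ y, F y ≠ ⊥ := fun y h => by
    have := hle x₀ hx₀ y
    rw [h, le_bot_iff] at this
    exact EReal.coe_ne_bot _ this
  have hcoe : ∀ {y}, F y ≠ ⊤ → ((F y).toReal : EReal) = F y := fun h =>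
    EReal.coe_toReal h (hbot _)
  have hyoung : ∀ x ∈ D, ∀ y, F y ≠ ⊤ → ⟪x, y⟫ ≤ φ x + (F y).toReal := by
    intro x hx y hy
    have := hle x hx y
    rw [← hcoe hy] at this
    have : ⟪x, y⟫ - φ x ≤ (F y).toReal := by exact_mod_cast this
    linarith
  refine ⟨{y | F y ≠ ⊤}, fun y => (F y).toReal, hFm (measurableSet_singleton _).compl,
    measurable_ereal_toReal.comp hFm, hyoung, ?_⟩
  rintro x y ⟨hx, h⟩
  have h1 : F y ≤ ((⟪x, y⟫ - φ x : ℝ) : EReal) := by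
    refine iSup_le fun z => ?_
    have := h z.1 z.2
    rw [inner_sub_right, real_inner_comm, real_inner_comm x y] at this
    exact_mod_cast (by linarith : ⟪z.1, y⟫ - φ z.1 ≤ ⟪x, y⟫ - φ x)
  have h2 : F y ≠ ⊤ := fun h => by
    rw [h, top_le_iff] at h1
    exact EReal.coe_ne_top _ h1
  refine ⟨h2, ?_⟩
  rw [← hcoe h2] at h1
  have h3 : (F y).toReal ≤ ⟪x, y⟫ - φ x := by exact_mod_cast h1
  have := hyoung x hx y h2
  linarith

lemma isSubgradientOn_of_young_eq {D D' : Set E} {φ ψ : E → ℝ}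
    (h : ∀ x ∈ D, ∀ y ∈ D', ⟪x, y⟫ ≤ φ x + ψ y) {x y : E} (hx : x ∈ D) (hy : y ∈ D')
    (heq : φ x + ψ y = ⟪x, y⟫) : IsSubgradientOn D φ x y := by
  refine ⟨hx, fun z hz => ?_⟩
  have := h z hz y hy
  rw [inner_sub_right, real_inner_comm, real_inner_comm x y]
  linarith

lemma IsSubgradientOn.eq_gradient [CompleteSpace E] {D : Set E} {φ : E → ℝ} {x y : E}
    (h : IsSubgradientOn D φ x y) (hx : x ∈ interior D) (hd : DifferentiableAt ℝ φ x) :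
    y = gradient φ x := by
  have hmin : IsLocalMin (fun z => φ z - ⟪y, z⟫) x := by
    filter_upwards [mem_interior_iff_mem_nhds.1 hx] with z hz
    have := h.2 z hz
    rw [inner_sub_right] at this
    linarith
  have hder : HasFDerivAt (fun z => φ z - ⟪y, z⟫) (fderiv ℝ φ x - innerSL ℝ y) x :=
    hd.hasFDerivAt.sub (innerSL ℝ y).hasFDerivAt
  have h0 := hmin.hasFDerivAt_eq_zero hder
  rw [gradient, sub_eq_zero.1 h0]
  exact ((InnerProductSpace.toDual ℝ E).symm_apply_apply y).symm

/-- A convex function is almost everywhere differentiable on its domain. -/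
theorem _root_.ConvexOn.ae_differentiableAt [FiniteDimensional ℝ E] [MeasurableSpace E]
    [BorelSpace E] {D : Set E} {φ : E → ℝ} (hφ : ConvexOn ℝ D φ) (vol : Measure E)
    [vol.IsAddHaarMeasure] :
    ∀ᵐ x ∂vol, x ∈ D → x ∈ interior D ∧ DifferentiableAt ℝ φ x := by
  have hfr : ∀ᵐ x ∂vol, x ∉ frontier D := by
    rw [ae_iff]
    simpa using hφ.1.addHaar_frontier vol
  have hloc := hφ.locallyLipschitzOn_interior
  have hdiff : ∀ᵐ x ∂vol, x ∈ interior D → DifferentiableAt ℝ φ x := by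
    have hpt : ∀ x ∈ interior D, ∃ U ∈ 𝓝[interior D] x,
        ∀ᵐ y ∂vol, y ∈ U → DifferentiableAt ℝ φ y := by
      intro x hx
      obtain ⟨K, t, ht, hK⟩ := hloc hx
      rw [isOpen_interior.nhdsWithin_eq hx] at ht
      refine ⟨interior t, mem_nhdsWithin_of_mem_nhds (interior_mem_nhds.2 ht), ?_⟩
      filter_upwards [hK.ae_differentiableWithinAt_of_mem (μ := vol)] with y hy hyt
      exact (hy (interior_subset hyt)).differentiableAt (mem_interior_iff_mem_nhds.1 hyt)
    choose! U hU hUd using hpt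
    obtain ⟨t, hts, htc, hcov⟩ := TopologicalSpace.countable_cover_nhdsWithin hU
    have : ∀ᵐ y ∂vol, ∀ x ∈ t, y ∈ U x → DifferentiableAt ℝ φ y :=
      (ae_ball_iff htc).2 fun x hx => hUd x (hts hx)
    filter_upwards [this] with y hy hyD
    obtain ⟨x, hx, hyx⟩ := Set.mem_iUnion₂.1 (hcov hyD)
    exact hy x hx hyx
  filter_upwards [hfr, hdiff] with x h1 h2 hx
  have h3 : x ∈ interior D := by
    by_contra h
    exact h1 ⟨subset_closure hx, h⟩
  exact ⟨h3, h2 h3⟩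

end ConvexAnalysis

section Brenier

open scoped RealInnerProductSpace

variable {d : ℕ}

lemma integral_norm_sq_eq_of_map_eq {μ ν : Measure (Rd d)} {T : Rd d → Rd d} (hT : Measurable T)
    (h : μ.map T = ν) : ∫ x, ‖T x‖ ^ 2 ∂μ = ∫ y, ‖y‖ ^ 2 ∂ν := by
  rw [← h, integral_map hT.aemeasurable (by fun_prop)]

lemma memLp_of_map_eq {μ ν : Measure (Rd d)} {T : Rd d → Rd d} (hT : Measurable T)
    (h : μ.map T = ν) (hν2 : MemLp id 2 ν) : MemLp T 2 μ := by
  subst h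
  exact (memLp_map_measure_iff (by fun_prop) hT.aemeasurable).1 hν2

lemma integrable_inner_of_memLp {μ : Measure (Rd d)} {S T : Rd d → Rd d} (hS : MemLp S 2 μ)
    (hT : MemLp T 2 μ) : Integrable (fun x => ⟪S x, T x⟫) μ :=
  (hS.norm.integrable_mul hT.norm).mono' (hS.1.inner hT.1)
    (ae_of_all _ fun x => norm_inner_le_norm (S x) (T x))

lemma integral_norm_sub_sq {μ : Measure (Rd d)} (hμ2 : MemLp id 2 μ) {T : Rd d → Rd d}
    (hT2 : MemLp T 2 μ) :
    ∫ x, ‖x - T x‖ ^ 2 ∂μ = ∫ x, ‖x‖ ^ 2 ∂μ - 2 * ∫ x, ⟪x, T x⟫ ∂μ + ∫ x, ‖T x‖ ^ 2 ∂μ := by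
  have h1 : Integrable (fun x => ‖x‖ ^ 2) μ := hμ2.integrable_norm_pow (by norm_num)
  have h2 : Integrable (fun x => ‖T x‖ ^ 2) μ := hT2.integrable_norm_pow (by norm_num)
  have h3 : Integrable (fun x => ⟪x, T x⟫) μ := integrable_inner_of_memLp hμ2 hT2
  simp_rw [norm_sub_sq_real]
  rw [integral_add (by exact h1.sub (h3.const_mul 2)) h2, integral_sub h1 (h3.const_mul 2),
    integral_const_mul]

lemma lintegral_enorm_sq_eq {α : Type*} [MeasurableSpace α] {μ : Measure α} {f : α → Rd d}
    (hf : MemLp f 2 μ) : ∫⁻ x, ‖f x‖ₑ ^ 2 ∂μ = ENNReal.ofReal (∫ x, ‖f x‖ ^ 2 ∂μ) := by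
  rw [ofReal_integral_eq_lintegral_ofReal (hf.integrable_norm_pow (by norm_num))
    (ae_of_all _ fun x => by positivity)]
  refine lintegral_congr fun x => ?_
  rw [ENNReal.ofReal_pow (norm_nonneg _), ofReal_norm]

/-- A Monge map maximizes the correlation with the identity. -/
lemma IsMongeMap.integral_inner_le {μ ν : Measure (Rd d)} (hμ2 : MemLp id 2 μ)
    (hν2 : MemLp id 2 ν) {T : Rd d → Rd d} (hT : IsMongeMap μ ν T) {S : Rd d → Rd d}
    (hS : Measurable S) (hSν : μ.map S = ν) :
    ∫ x, ⟪x, S x⟫ ∂μ ≤ ∫ x, ⟪x, T x⟫ ∂μ := by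
  obtain ⟨hTm, hTν, hmin⟩ := hT
  have hT2 := memLp_of_map_eq hTm hTν hν2
  have hS2 := memLp_of_map_eq hS hSν hν2
  have h := hmin S hS hSν
  rw [lintegral_enorm_sq_eq (f := fun x => x - T x) (hμ2.sub hT2),
    lintegral_enorm_sq_eq (f := fun x => x - S x) (hμ2.sub hS2),
    ENNReal.ofReal_le_ofReal_iff (integral_nonneg fun x => by positivity),
    integral_norm_sub_sq hμ2 hT2, integral_norm_sub_sq hμ2 hS2,
    integral_norm_sq_eq_of_map_eq hTm hTν, integral_norm_sq_eq_of_map_eq hS hSν] at h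
  linarith

lemma measurable_gradient (φ : Rd d → ℝ) : Measurable (gradient φ) :=
  (InnerProductSpace.toDual ℝ (Rd d)).symm.continuous.measurable.comp (measurable_fderiv ℝ φ)

/-- If the first marginal is absolutely continuous, then a plan between `μ` and `ν` that is
concentrated on a cyclically monotone set is induced by the Monge map. -/
theorem IsMongeMap.eq_map_of_isCyclicallyMonotone {μ ν : Measure (Rd d)} (hμ2 : MemLp id 2 μ)
    (hν2 : MemLp id 2 ν) (hac : μ ≪ volume) {T : Rd d → Rd d} (hT : IsMongeMap μ ν T)
    (γ : Measure (Rd d × Rd d)) [IsProbabilityMeasure γ] (hfst : γ.map Prod.fst = μ)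
    (hsnd : γ.map Prod.snd = ν) {G : Set (Rd d × Rd d)} (hG : IsCyclicallyMonotone G)
    (hγG : ∀ᵐ z ∂γ, z ∈ G) :
    γ = μ.map (fun x => (x, T x)) := by
  obtain ⟨hTm, hTν, -⟩ := id hT
  have : IsProbabilityMeasure μ := hfst ▸ Measure.isProbabilityMeasure_map (by fun_prop)
  have : IsProbabilityMeasure ν := hsnd ▸ Measure.isProbabilityMeasure_map (by fun_prop)
  obtain ⟨D, φ, hDm, hφm, hφc, hsub⟩ := hG.exists_potential hγG.exists
  obtain ⟨z₀, hz₀⟩ := hγG.exists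
  obtain ⟨D', ψ, hDm', hψm, hyoung, hconj⟩ := exists_conjugate D φ ⟨z₀.1, (hsub z₀ hz₀).1⟩
  have hdiff : ∀ᵐ x ∂μ, x ∈ D → x ∈ interior D ∧ DifferentiableAt ℝ φ x :=
    hac.ae_le (hφc.ae_differentiableAt volume)
  set S : Rd d → Rd d := gradient φ with hS
  have hSm : Measurable S := measurable_gradient φ
  have hγS : ∀ᵐ z ∂γ, z.2 = S z.1 := by
    have h := ae_of_ae_map (f := Prod.fst) (by fun_prop) (hfst.symm ▸ hdiff)
    filter_upwards [h, hγG] with z hz hzG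
    have hs := hsub z hzG
    exact hs.eq_gradient (hz hs.1).1 (hz hs.1).2
  have hγeq : γ = μ.map (fun x => (x, S x)) := by
    rw [← hfst, Measure.map_map (by fun_prop) (by fun_prop)]
    conv_lhs => rw [← Measure.map_id (μ := γ)]
    refine Measure.map_congr ?_
    filter_upwards [hγS] with z hz
    exact Prod.ext rfl hz
  have hSν : μ.map S = ν := by
    rw [← hsnd, hγeq, Measure.map_map (by fun_prop) (by fun_prop)]
    rfl
  have hSsub : ∀ᵐ x ∂μ, x ∈ D ∧ S x ∈ D' ∧ φ x + ψ (S x) = ⟪x, S x⟫ := by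
    have hm : MeasurableSet {x | x ∈ D ∧ S x ∈ D' ∧ φ x + ψ (S x) = ⟪x, S x⟫} :=
      hDm.inter ((hSm hDm').inter (measurableSet_eq_fun (by fun_prop) (by fun_prop)))
    rw [← hfst, ae_map_iff (by fun_prop) hm]
    filter_upwards [hγG, hγS] with z hz hzS
    have h := hconj _ _ (hsub z hz)
    rw [hzS] at h
    exact ⟨(hsub z hz).1, h⟩
  have hTD' : ∀ᵐ x ∂μ, T x ∈ D' := by
    refine ae_of_ae_map (p := fun y => y ∈ D') hTm.aemeasurable ?_
    rw [hTν, ← hSν]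
    refine (ae_map_iff hSm.aemeasurable hDm').2 ?_
    filter_upwards [hSsub] with x hx using hx.2.1
  have hT2 := memLp_of_map_eq hTm hTν hν2
  have hS2 := memLp_of_map_eq hSm hSν hν2
  have hiT : Integrable (fun x => ⟪x, T x⟫) μ := integrable_inner_of_memLp hμ2 hT2
  have hiS : Integrable (fun x => ⟪x, S x⟫) μ := integrable_inner_of_memLp hμ2 hS2
  obtain ⟨x₀, hx₀D, hx₀D', -⟩ := hSsub.exists
  have hφi : Integrable φ μ := by
    refine integrable_of_le_of_le (g₁ := fun x => ⟪x, S x₀⟫ - ψ (S x₀))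
      (g₂ := fun x => ⟪x, S x⟫ - (⟪x₀, S x⟫ - φ x₀)) hφm.aestronglyMeasurable ?_ ?_ ?_ ?_
    · filter_upwards [hSsub] with x hx
      linarith [hyoung x hx.1 _ hx₀D']
    · filter_upwards [hSsub] with x hx
      linarith [hyoung x₀ hx₀D _ hx.2.1, hx.2.2]
    · exact ((hμ2.integrable (by norm_num)).inner_const _).sub (integrable_const _)
    · exact hiS.sub (((hS2.integrable (by norm_num)).const_inner _).sub (integrable_const _))
  have hψS : (fun x => ψ (S x)) =ᵐ[μ] fun x => ⟪x, S x⟫ - φ x := by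
    filter_upwards [hSsub] with x hx
    linarith [hx.2.2]
  have hψSi : Integrable (fun x => ψ (S x)) μ := (hiS.sub hφi).congr hψS.symm
  have hψi : Integrable ψ ν := by
    rw [← hSν, integrable_map_measure hψm.aestronglyMeasurable hSm.aemeasurable]
    exact hψSi
  have hψTi : Integrable (fun x => ψ (T x)) μ := by
    rw [← hTν, integrable_map_measure hψm.aestronglyMeasurable hTm.aemeasurable] at hψi
    exact hψi
  have hψTS : ∫ x, ψ (T x) ∂μ = ∫ x, ψ (S x) ∂μ := by
    rw [← integral_map hTm.aemeasurable hψm.aestronglyMeasurable,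
      ← integral_map hSm.aemeasurable hψm.aestronglyMeasurable, hTν, hSν]
  have hgap : 0 ≤ᵐ[μ] fun x => φ x + ψ (T x) - ⟪x, T x⟫ := by
    filter_upwards [hSsub, hTD'] with x hx hxT
    have := hyoung x hx.1 _ hxT
    simp only [Pi.zero_apply]
    linarith
  have hgap0 : ∫ x, (φ x + ψ (T x) - ⟪x, T x⟫) ∂μ = 0 := by
    refine le_antisymm ?_ (integral_nonneg_of_ae hgap)
    rw [integral_sub (by exact hφi.add hψTi) hiT, integral_add hφi hψTi, hψTS, integral_congr_ae hψS,
      integral_sub hiS hφi]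
    linarith [hT.integral_inner_le hμ2 hν2 hSm hSν]
  have hTS : S =ᵐ[μ] T := by
    filter_upwards [(integral_eq_zero_iff_of_nonneg_ae hgap ((hφi.add hψTi).sub hiT)).1 hgap0,
      hSsub, hTD', hdiff] with x hx hxS hxT hxd
    have hs := isSubgradientOn_of_young_eq hyoung hxS.1 hxT
      (by simp only [Pi.zero_apply] at hx; linarith)
    exact (hs.eq_gradient (hxd hxS.1).1 (hxd hxS.1).2).symm
  rw [hγeq]
  refine Measure.map_congr ?_
  filter_upwards [hTS] with x hx
  rw [hx]

end Brenier

section DiscretePlans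

open scoped RealInnerProductSpace

variable {d : ℕ}

/-- Permuting atoms of equal mass does not improve an optimal plan of finite cost. -/
lemma IsOptimalPlan.sum_norm_sub_sq_le {μ ν : Measure (Rd d)}
    {γ : ProbabilityMeasure (Rd d × Rd d)} (hγ : IsOptimalPlan μ ν γ) (hfin : quadraticCost γ ≠ ∞)
    {ι : Type*} [Fintype ι] [Nonempty ι] (z : ι → Rd d × Rd d)
    (hz : ∀ i, (γ : Measure (Rd d × Rd d)) {z i} ≠ 0) (σ : Equiv.Perm ι) :
    ∑ i, ‖(z i).1 - (z i).2‖ ^ 2 ≤ ∑ i, ‖(z (σ i)).1 - (z i).2‖ ^ 2 := by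
  obtain ⟨⟨hfst, hsnd⟩, hopt⟩ := hγ
  set Γ : Measure (Rd d × Rd d) := (γ : Measure (Rd d × Rd d)) with hΓ
  obtain ⟨i₀, hi₀⟩ := Finite.exists_min fun i => Γ {z i}
  set ε : ℝ≥0∞ := Γ {z i₀} / Fintype.card ι with hε
  have hcard : (Fintype.card ι : ℝ≥0∞) ≠ 0 := by simp
  have hε0 : ε ≠ 0 := ENNReal.div_ne_zero.2 ⟨hz i₀, by simp⟩
  have hεtop : ε ≠ ∞ := ENNReal.div_ne_top (measure_ne_top _ _) hcard
  set A : Measure (Rd d × Rd d) := ∑ i, ε • Measure.dirac (z i) with hA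
  set B : Measure (Rd d × Rd d) := ∑ i, ε • Measure.dirac ((z (σ i)).1, (z i).2) with hB
  have hAle : A ≤ Γ := by
    refine Measure.le_iff.2 fun s hs => ?_
    rw [hA, Measure.finsetSum_apply]
    have : ∀ i ∈ Finset.univ, (ε • Measure.dirac (z i)) s ≤ Γ s / Fintype.card ι := by
      intro i _
      rw [Measure.smul_apply, Measure.dirac_apply' _ hs, smul_eq_mul]
      by_cases h : z i ∈ s
      · rw [Set.indicator_of_mem h, Pi.one_apply, mul_one, hε]
        refine ENNReal.div_le_div_right ?_ _
        exact (hi₀ i).trans (measure_mono (Set.singleton_subset_iff.2 h))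
      · simp [Set.indicator_of_notMem h]
    refine (Finset.sum_le_sum this).trans ?_
    rw [Finset.sum_const, Finset.card_univ, nsmul_eq_mul,
      ENNReal.mul_div_cancel hcard (by simp)]
  have : IsFiniteMeasure A := isFiniteMeasure_of_le Γ hAle
  set ρ : Measure (Rd d × Rd d) := Γ - A with hρ
  have hRA : ρ + A = Γ := Measure.sub_add_cancel_of_le hAle
  have hABfst : A.map Prod.fst = B.map Prod.fst := by
    rw [hA, hB, Measure.map_finset_sum (by fun_prop), Measure.map_finset_sum (by fun_prop)]
    simp_rw [Measure.map_smul, Measure.map_dirac' measurable_fst]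
    exact (Equiv.sum_comp σ fun i => ε • Measure.dirac (z i).1).symm
  have hABsnd : A.map Prod.snd = B.map Prod.snd := by
    rw [hA, hB, Measure.map_finset_sum (by fun_prop), Measure.map_finset_sum (by fun_prop)]
    simp_rw [Measure.map_smul, Measure.map_dirac' measurable_snd]
  have hfst' : (ρ + B).map Prod.fst = μ := by
    rw [← hfst, ← hRA, Measure.map_add _ _ measurable_fst, Measure.map_add _ _ measurable_fst,
      hABfst]
  have hsnd' : (ρ + B).map Prod.snd = ν := by
    rw [← hsnd, ← hRA, Measure.map_add _ _ measurable_snd, Measure.map_add _ _ measurable_snd,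
      hABsnd]
  have hprob : IsProbabilityMeasure (ρ + B) := by
    constructor
    have h1 := Measure.map_apply measurable_fst MeasurableSet.univ (μ := ρ + B)
    have h2 := Measure.map_apply measurable_fst MeasurableSet.univ (μ := Γ)
    rw [hfst', ← hfst, Set.preimage_univ] at h1
    rw [← h1, h2]
    simp
  have hle : quadraticCost γ ≤ quadraticCost ⟨ρ + B, hprob⟩ := by
    rw [hopt]
    exact iInf₂_le (⟨ρ + B, hprob⟩ : ProbabilityMeasure (Rd d × Rd d)) ⟨hfst', hsnd'⟩
  have hm : Measurable fun z : Rd d × Rd d => ‖z.1 - z.2‖ₑ ^ 2 := by fun_prop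
  have hcγ : quadraticCost γ = (∫⁻ z, ‖z.1 - z.2‖ₑ ^ 2 ∂ρ)
      + ε * ∑ i, ‖(z i).1 - (z i).2‖ₑ ^ 2 := by
    change ∫⁻ z, ‖z.1 - z.2‖ₑ ^ 2 ∂Γ = _
    rw [← hRA, lintegral_add_measure, hA, lintegral_finsetSum_measure, Finset.mul_sum]
    simp_rw [lintegral_smul_measure, lintegral_dirac' _ hm, smul_eq_mul]
  have hcB : quadraticCost ⟨ρ + B, hprob⟩ = (∫⁻ z, ‖z.1 - z.2‖ₑ ^ 2 ∂ρ)
      + ε * ∑ i, ‖(z (σ i)).1 - (z i).2‖ₑ ^ 2 := by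
    change ∫⁻ z, ‖z.1 - z.2‖ₑ ^ 2 ∂(ρ + B) = _
    rw [lintegral_add_measure, hB, lintegral_finsetSum_measure, Finset.mul_sum]
    simp_rw [lintegral_smul_measure, lintegral_dirac' _ hm, smul_eq_mul]
  have hRfin : ∫⁻ z, ‖z.1 - z.2‖ₑ ^ 2 ∂ρ ≠ ∞ := by
    rw [hcγ] at hfin
    exact (ENNReal.add_ne_top.1 hfin).1
  rw [hcγ, hcB, ENNReal.add_le_add_iff_left hRfin, ENNReal.mul_le_mul_iff_right hε0 hεtop] at hle
  have hconv : ∀ f : ι → Rd d, ∑ i, ‖f i‖ₑ ^ 2 = ENNReal.ofReal (∑ i, ‖f i‖ ^ 2) := by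
    intro f
    rw [ENNReal.ofReal_sum_of_nonneg fun i _ => by positivity]
    refine Finset.sum_congr rfl fun i _ => ?_
    rw [ENNReal.ofReal_pow (norm_nonneg _), ofReal_norm]
  rw [hconv, hconv, ENNReal.ofReal_le_ofReal_iff (Finset.sum_nonneg fun i _ => by positivity)] at hle
  exact hle

/-- The atoms of an optimal plan of finite cost form a cyclically monotone set. -/
theorem IsOptimalPlan.isCyclicallyMonotone_atoms {μ ν : Measure (Rd d)}
    {γ : ProbabilityMeasure (Rd d × Rd d)} (hγ : IsOptimalPlan μ ν γ)
    (hfin : quadraticCost γ ≠ ∞) :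
    IsCyclicallyMonotone {z | (γ : Measure (Rd d × Rd d)) {z} ≠ 0} := by
  intro k z hz
  have h := hγ.sum_norm_sub_sq_le hfin (fun i : Fin (k + 1) => z i) (fun i => hz i)
    (finRotate (k + 1))
  have hinner : ∑ i : Fin (k + 1), ⟪(z i).2, (z (finRotate (k + 1) i : Fin (k + 1))).1 - (z i).1⟫
      ≤ 0 := by
    have hperm := Equiv.sum_comp (finRotate (k + 1)) fun i : Fin (k + 1) => ‖(z i).1‖ ^ 2
    simp_rw [norm_sub_sq_real, Finset.sum_add_distrib, Finset.sum_sub_distrib, hperm,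
      ← Finset.mul_sum] at h
    simp_rw [inner_sub_right, Finset.sum_sub_distrib]
    simp_rw [real_inner_comm]
    simp_rw [real_inner_comm] at h
    linarith
  rw [Fin.sum_univ_castSucc, finRotate_last] at hinner
  simp only [Fin.val_castSucc, Fin.val_last, Fin.val_zero] at hinner
  rw [← Fin.sum_univ_eq_sum_range fun i => ⟪(z i).2, (z (i + 1)).1 - (z i).1⟫]
  convert! hinner using 3 with i
  simp

lemma ae_mem_atoms_of_finite {α : Type*} [MeasurableSpace α] {γ : Measure α}
    {F : Set α} (hF : F.Finite) (h : ∀ᵐ z ∂γ, z ∈ F) : ∀ᵐ z ∂γ, γ {z} ≠ 0 := by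
  have h' : ∀ᵐ z ∂γ, z ∉ F ∩ {z | γ {z} = 0} := by
    refine measure_eq_zero_iff_ae_notMem.1 ?_
    rw [← Set.biUnion_of_singleton (F ∩ {z | γ {z} = 0})]
    exact (measure_biUnion_null_iff (hF.inter_of_left _).countable).2 fun z hz => hz.2
  filter_upwards [h, h'] with z h1 h2 h3
  exact h2 ⟨h1, h3⟩

lemma quadraticCost_ne_top_of_finite {γ : ProbabilityMeasure (Rd d × Rd d)}
    {F : Set (Rd d × Rd d)} (hF : F.Finite) (h : ∀ᵐ z ∂(γ : Measure (Rd d × Rd d)), z ∈ F) :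
    quadraticCost γ ≠ ∞ := by
  rw [quadraticCost, ← Measure.restrict_eq_self_of_ae_mem h]
  have := setLIntegral_lt_top_of_isCompact (μ := (γ : Measure (Rd d × Rd d)))
    (f := fun z : Rd d × Rd d => ‖z.1 - z.2‖₊ ^ 2) (measure_ne_top _ _) hF.isCompact (by fun_prop)
  simpa [enorm_eq_nnnorm] using this.ne

/-- The support of a weak limit of measures concentrated on cyclically monotone sets is
cyclically monotone. -/
theorem isCyclicallyMonotone_support_of_tendsto {ι : Type*} {L : Filter ι} [L.NeBot]
    {γs : ι → ProbabilityMeasure (Rd d × Rd d)} {γ : ProbabilityMeasure (Rd d × Rd d)}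
    (hlim : Tendsto γs L (𝓝 γ)) {A : ι → Set (Rd d × Rd d)}
    (hA : ∀ᶠ n in L, IsCyclicallyMonotone (A n) ∧
      ∀ᵐ z ∂(γs n : Measure (Rd d × Rd d)), z ∈ A n) :
    IsCyclicallyMonotone (γ : Measure (Rd d × Rd d)).support := by
  intro k z hz
  by_contra! hpos
  set s : Set (ℕ → Rd d × Rd d) := {w | 0 < ∑ i ∈ Finset.range k,
    ⟪(w i).2, (w (i + 1)).1 - (w i).1⟫ + ⟪(w k).2, (w 0).1 - (w k).1⟫} with hs
  have hso : IsOpen s := isOpen_lt continuous_const (by fun_prop)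
  obtain ⟨I, u, hu, hIs⟩ := isOpen_pi_iff.1 hso z hpos
  have hev : ∀ᶠ n in L, ∀ i ∈ I, 0 < (γs n : Measure (Rd d × Rd d)) (u i) := by
    refine (Filter.eventually_all_finset I).2 fun i hi => ?_
    refine eventually_lt_of_lt_liminf (lt_of_lt_of_le ?_
      (ProbabilityMeasure.le_liminf_measure_open_of_tendsto hlim (hu i hi).1))
    exact (Measure.mem_support_iff_forall _).1 (hz i) _ ((hu i hi).1.mem_nhds (hu i hi).2)
  obtain ⟨n, ⟨hmono, hae⟩, hn⟩ := (hA.and hev).exists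
  have hex : ∀ i, ∃ w ∈ A n, i ∈ I → w ∈ u i := by
    intro i
    by_cases hi : i ∈ I
    · have : ∃ᵐ z ∂(γs n : Measure (Rd d × Rd d)), z ∈ u i :=
        frequently_ae_mem_iff.2 (hn i hi).ne'
      obtain ⟨w, hw1, hw2⟩ := (this.and_eventually hae).exists
      exact ⟨w, hw2, fun _ => hw1⟩
    · obtain ⟨w, hw⟩ := hae.exists
      exact ⟨w, hw, fun h => absurd h hi⟩
  choose w hwA hwu using hex
  have : w ∈ s := hIs fun i hi => hwu i hi
  exact absurd (hmono k w hwA) (not_le.2 this)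

end DiscretePlans

section Barycentric

variable {d : ℕ}

lemma measurable_barycentricProjection (γ : ProbabilityMeasure (Rd d × Rd d)) :
    Measurable (barycentricProjection γ) :=
  (StronglyMeasurable.integral_kernel (κ := (γ : Measure (Rd d × Rd d)).condKernel)
    (f := fun y : Rd d => y) stronglyMeasurable_id).measurable

lemma lintegral_fst_eq_lintegral (γ : Measure (Rd d × Rd d)) {f : Rd d → ℝ≥0∞}
    (hf : Measurable f) : ∫⁻ x, f x ∂γ.fst = ∫⁻ z, f z.1 ∂γ :=
  lintegral_map hf measurable_fst

/-- The barycentric projection is at least as close to any function of the first coordinate as the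
second coordinate is, on average. -/
lemma lintegral_enorm_barycentricProjection_sub_le (γ : ProbabilityMeasure (Rd d × Rd d))
    {g : Rd d → Rd d} (hg : Measurable g) :
    ∫⁻ z, ‖barycentricProjection γ z.1 - g z.1‖ₑ ∂(γ : Measure (Rd d × Rd d))
      ≤ ∫⁻ z, ‖z.2 - g z.1‖ₑ ∂(γ : Measure (Rd d × Rd d)) := by
  set Γ : Measure (Rd d × Rd d) := (γ : Measure (Rd d × Rd d)) with hΓ
  have hb := measurable_barycentricProjection γ
  rw [← lintegral_fst_eq_lintegral Γ (f := fun x => ‖barycentricProjection γ x - g x‖ₑ)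
    (by fun_prop), ← Measure.lintegral_condKernel (ρ := Γ) (f := fun z => ‖z.2 - g z.1‖ₑ)
    (by fun_prop)]
  refine lintegral_mono fun x => ?_
  by_cases hi : Integrable (fun y : Rd d => y) (Γ.condKernel x)
  · have : barycentricProjection γ x - g x = ∫ y, (y - g x) ∂(Γ.condKernel x) := by
      rw [integral_sub hi (integrable_const _), integral_const]
      simp [barycentricProjection, hΓ]
    rw [this]
    exact enorm_integral_le_lintegral_enorm _
  · have htop : ∫⁻ y, ‖y - g x‖ₑ ∂(Γ.condKernel x) = ∞ := by
      by_contra hne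
      refine hi ?_
      have h1 : Integrable (fun y : Rd d => y - g x) (Γ.condKernel x) :=
        ⟨by fun_prop, lt_top_iff_ne_top.2 hne⟩
      exact (h1.add (integrable_const (g x))).congr (ae_of_all _ fun y => sub_add_cancel y (g x))
    simp [htop]

lemma lintegral_enorm_barycentricProjection_sub_snd_le (γ : ProbabilityMeasure (Rd d × Rd d))
    {g : Rd d → Rd d} (hg : Measurable g) :
    ∫⁻ z, ‖barycentricProjection γ z.1 - z.2‖ₑ ∂(γ : Measure (Rd d × Rd d))
      ≤ 2 * ∫⁻ z, ‖z.2 - g z.1‖ₑ ∂(γ : Measure (Rd d × Rd d)) := by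
  have hb := measurable_barycentricProjection γ
  calc ∫⁻ z, ‖barycentricProjection γ z.1 - z.2‖ₑ ∂(γ : Measure (Rd d × Rd d))
      ≤ ∫⁻ z, (‖barycentricProjection γ z.1 - g z.1‖ₑ + ‖z.2 - g z.1‖ₑ)
          ∂(γ : Measure (Rd d × Rd d)) := by
        refine lintegral_mono fun z => ?_
        have := enorm_sub_le (a := barycentricProjection γ z.1 - g z.1) (b := z.2 - g z.1)
        rwa [sub_sub_sub_cancel_right] at this
    _ = (∫⁻ z, ‖barycentricProjection γ z.1 - g z.1‖ₑ ∂(γ : Measure (Rd d × Rd d)))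
          + ∫⁻ z, ‖z.2 - g z.1‖ₑ ∂(γ : Measure (Rd d × Rd d)) :=
        lintegral_add_left (by fun_prop) _
    _ ≤ _ := by
        rw [two_mul]
        exact add_le_add (lintegral_enorm_barycentricProjection_sub_le γ hg) le_rfl

/-- Jensen's inequality for the barycentric projection. -/
lemma lintegral_enorm_sq_barycentricProjection_le (γ : ProbabilityMeasure (Rd d × Rd d)) :
    ∫⁻ x, ‖barycentricProjection γ x‖ₑ ^ 2 ∂(γ : Measure (Rd d × Rd d)).fst
      ≤ ∫⁻ z, ‖z.2‖ₑ ^ 2 ∂(γ : Measure (Rd d × Rd d)) := by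
  set Γ : Measure (Rd d × Rd d) := (γ : Measure (Rd d × Rd d)) with hΓ
  rw [← Measure.lintegral_condKernel (ρ := Γ) (f := fun z => ‖z.2‖ₑ ^ 2) (by fun_prop)]
  refine lintegral_mono fun x => ?_
  have h1 : ‖barycentricProjection γ x‖ₑ ≤ eLpNorm (fun y : Rd d => y) 1 (Γ.condKernel x) := by
    rw [eLpNorm_one_eq_lintegral_enorm]
    exact enorm_integral_le_lintegral_enorm _
  have h2 : eLpNorm (fun y : Rd d => y) 1 (Γ.condKernel x)
      ≤ eLpNorm (fun y : Rd d => y) 2 (Γ.condKernel x) :=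
    eLpNorm_le_eLpNorm_of_exponent_le (by norm_num) (by fun_prop)
  have h3 := eLpNorm_nnreal_pow_eq_lintegral (f := fun y : Rd d => y) (p := 2)
    (μ := Γ.condKernel x) (by norm_num)
  simp only [NNReal.coe_ofNat, ENNReal.rpow_ofNat, ENNReal.coe_ofNat] at h3
  calc ‖barycentricProjection γ x‖ₑ ^ 2 ≤ eLpNorm (fun y : Rd d => y) 2 (Γ.condKernel x) ^ 2 := by
        gcongr
        exact h1.trans h2
    _ = _ := h3

/-- The law of `(x, T x)` under `μ`. -/
noncomputable def graphPlan (μ : Measure (Rd d)) [IsProbabilityMeasure μ] (T : Rd d → Rd d)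
    (hT : Measurable T) : ProbabilityMeasure (Rd d × Rd d) :=
  ⟨μ.map fun x => (x, T x), Measure.isProbabilityMeasure_map (by fun_prop)⟩

lemma enorm_sub_le_truncation {y v : Rd d} {M R : ℝ} (hR : 0 < R) (hv : ‖v‖ ≤ M) :
    ‖y - v‖ₑ ≤ ENNReal.ofReal (min ‖y - v‖ R) + ENNReal.ofReal (2 / R) * ‖y‖ₑ ^ 2
      + ENNReal.ofReal (2 * M ^ 2 / R) := by
  rw [← ofReal_norm, ← ofReal_norm, ← ENNReal.ofReal_pow (norm_nonneg _),
    ← ENNReal.ofReal_mul (by positivity), ← ENNReal.ofReal_add (by positivity) (by positivity),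
    ← ENNReal.ofReal_add (by positivity) (by positivity)]
  refine ENNReal.ofReal_le_ofReal ?_
  rcases le_total ‖y - v‖ R with h | h
  · rw [min_eq_left h]
    have h1 : 0 ≤ 2 / R * ‖y‖ ^ 2 := by positivity
    have h2 : 0 ≤ 2 * M ^ 2 / R := by positivity
    linarith
  · rw [min_eq_right h]
    have h1 : ‖y - v‖ ^ 2 ≤ 2 * ‖y‖ ^ 2 + 2 * M ^ 2 := by
      have h2 : ‖y - v‖ ≤ ‖y‖ + M := (norm_sub_le y v).trans (by gcongr)
      have h3 : ‖y - v‖ ^ 2 ≤ (‖y‖ + M) ^ 2 := by gcongr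
      nlinarith [sq_nonneg (‖y‖ - M)]
    have h2 : ‖y - v‖ ≤ ‖y - v‖ ^ 2 / R := by
      rw [le_div_iff₀ hR, sq]
      gcongr
    have h3 : ‖y - v‖ ^ 2 / R ≤ (2 * ‖y‖ ^ 2 + 2 * M ^ 2) / R := by gcongr
    have h4 : (2 * ‖y‖ ^ 2 + 2 * M ^ 2) / R = 2 / R * ‖y‖ ^ 2 + 2 * M ^ 2 / R := by
      field_simp
    linarith

/-- Along plans that converge weakly to a plan induced by a map, with bounded second moments, the
second coordinate is asymptotically a function of the first one. -/
theorem tendsto_lintegral_enorm_barycentricProjection_sub {μ : Measure (Rd d)}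
    [IsProbabilityMeasure μ] {T : Rd d → Rd d} (hT : Measurable T) (hTi : Integrable T μ)
    {γs : ℕ → ProbabilityMeasure (Rd d × Rd d)}
    (hlim : Tendsto γs atTop (𝓝 (graphPlan μ T hT))) {C : ℝ}
    (hC : ∀ᶠ n in atTop,
      ∫⁻ z, ‖z.2‖ₑ ^ 2 ∂(γs n : Measure (Rd d × Rd d)) ≤ ENNReal.ofReal C) :
    Tendsto (fun n => ∫⁻ z, ‖barycentricProjection (γs n) z.1 - z.2‖ₑ
      ∂(γs n : Measure (Rd d × Rd d))) atTop (𝓝 0) := by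
  wlog hC0 : 0 ≤ C generalizing C
  · refine this (C := 0) ?_ le_rfl
    simpa [ENNReal.ofReal_of_nonpos (not_le.1 hC0).le] using hC
  suffices h : ∀ ε : ℝ, 0 < ε → ∀ᶠ n in atTop, ∫⁻ z, ‖barycentricProjection (γs n) z.1 - z.2‖ₑ
      ∂(γs n : Measure (Rd d × Rd d)) ≤ ENNReal.ofReal (6 * ε) by
    refine ENNReal.tendsto_nhds_zero.2 fun δ hδ => ?_
    obtain ⟨r, hr0, hr⟩ := ENNReal.lt_iff_exists_real_btwn.1 hδ
    have hr0' : 0 < r := by simpa using hr.1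
    filter_upwards [h (r / 6) (by positivity)] with n hn
    refine hn.trans ?_
    rw [mul_div_cancel₀ _ (by norm_num)]
    exact hr.2.le
  intro ε hε
  obtain ⟨g, hgT, -⟩ := hTi.exists_boundedContinuous_integral_sub_le hε
  set M : ℝ := ‖g‖ with hM
  set R : ℝ := (2 * C + 2 * M ^ 2 + 1) / ε with hR
  have hR0 : 0 < R := by positivity
  have hRε : (2 * C + 2 * M ^ 2) / R ≤ ε := by
    rw [div_le_iff₀ hR0, hR, mul_div_cancel₀ _ hε.ne']
    linarith
  let h : (Rd d × Rd d) →ᵇ ℝ := BoundedContinuousFunction.ofNormedAddCommGroup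
    (fun z => min ‖z.2 - g z.1‖ R) (by fun_prop) R (fun z => by
      rw [Real.norm_of_nonneg (le_min (norm_nonneg _) hR0.le)]
      exact min_le_right _ _)
  have hh : ∀ z, h z = min ‖z.2 - g z.1‖ R := fun z => rfl
  have hlimh := ProbabilityMeasure.tendsto_iff_forall_integral_tendsto.1 hlim h
  have hhT : ∫ z, h z ∂(graphPlan μ T hT : Measure (Rd d × Rd d)) ≤ ε := by
    change ∫ z, h z ∂(μ.map fun x => (x, T x)) ≤ ε
    rw [integral_map (by fun_prop) h.continuous.aestronglyMeasurable]
    refine le_trans (integral_mono_of_nonneg (ae_of_all _ fun x => ?_) ?_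
      (ae_of_all _ fun x => ?_)) hgT
    · exact le_min (norm_nonneg _) hR0.le
    · exact (hTi.sub (g.integrable μ)).norm
    · exact min_le_left _ _
  filter_upwards [hlimh.eventually (gt_mem_nhds (lt_of_le_of_lt hhT (by linarith : ε < 2 * ε))), hC]
    with n hn hCn
  have key : ∫⁻ z, ‖z.2 - g z.1‖ₑ ∂(γs n : Measure (Rd d × Rd d)) ≤ ENNReal.ofReal (3 * ε) := by
    calc ∫⁻ z, ‖z.2 - g z.1‖ₑ ∂(γs n : Measure (Rd d × Rd d))
        ≤ ∫⁻ z, (ENNReal.ofReal (h z) + ENNReal.ofReal (2 / R) * ‖z.2‖ₑ ^ 2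
            + ENNReal.ofReal (2 * M ^ 2 / R)) ∂(γs n : Measure (Rd d × Rd d)) :=
          lintegral_mono fun z => enorm_sub_le_truncation hR0 (g.norm_coe_le_norm _)
      _ = ENNReal.ofReal (∫ z, h z ∂(γs n : Measure (Rd d × Rd d)))
            + ENNReal.ofReal (2 / R) * (∫⁻ z, ‖z.2‖ₑ ^ 2 ∂(γs n : Measure (Rd d × Rd d)))
            + ENNReal.ofReal (2 * M ^ 2 / R) := by
          have hm : Measurable fun z => ENNReal.ofReal (h z) :=
            h.continuous.measurable.ennreal_ofReal
          rw [lintegral_add_right _ measurable_const, lintegral_add_left hm,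
            lintegral_const_mul _ (by fun_prop), lintegral_const, measure_univ, mul_one,
            ofReal_integral_eq_lintegral_ofReal (h.integrable _)
              (ae_of_all _ fun z => le_min (norm_nonneg _) hR0.le)]
      _ ≤ ENNReal.ofReal (2 * ε) + ENNReal.ofReal (2 / R) * ENNReal.ofReal C
            + ENNReal.ofReal (2 * M ^ 2 / R) := by gcongr
      _ = ENNReal.ofReal (2 * ε + (2 * C + 2 * M ^ 2) / R) := by
          rw [← ENNReal.ofReal_mul (by positivity), ← ENNReal.ofReal_add (by positivity)
            (by positivity), ← ENNReal.ofReal_add (by positivity) (by positivity)]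
          congr 1
          ring
      _ ≤ ENNReal.ofReal (3 * ε) := ENNReal.ofReal_le_ofReal (by linarith)
  refine (lintegral_enorm_barycentricProjection_sub_snd_le (γs n)
    g.continuous.measurable).trans ?_
  calc 2 * ∫⁻ z, ‖z.2 - g z.1‖ₑ ∂(γs n : Measure (Rd d × Rd d))
      ≤ ENNReal.ofReal 2 * ENNReal.ofReal (3 * ε) := by
        rw [ENNReal.ofReal_ofNat]
        gcongr
    _ = ENNReal.ofReal (6 * ε) := by
        rw [← ENNReal.ofReal_mul (by norm_num)]
        congr 1
        ring

/-- Convergence of the laws of the barycentric projections. -/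
theorem tendsto_map_barycentricProjection {μ : Measure (Rd d)}
    [IsProbabilityMeasure μ] {T : Rd d → Rd d} (hT : Measurable T) (hTi : Integrable T μ)
    {γs : ℕ → ProbabilityMeasure (Rd d × Rd d)}
    (hlim : Tendsto γs atTop (𝓝 (graphPlan μ T hT))) {C : ℝ}
    (hC : ∀ᶠ n in atTop,
      ∫⁻ z, ‖z.2‖ₑ ^ 2 ∂(γs n : Measure (Rd d × Rd d)) ≤ ENNReal.ofReal C) (f : Rd d →ᵇ ℝ) :
    Tendsto (fun n => ∫ z, f (barycentricProjection (γs n) z.1) ∂(γs n : Measure (Rd d × Rd d)))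
      atTop (𝓝 (∫ x, f (T x) ∂μ)) := by
  have hm : ∀ n, Measurable fun z : Rd d × Rd d => barycentricProjection (γs n) z.1 := fun n =>
    (measurable_barycentricProjection (γs n)).comp measurable_fst
  let η : ℕ → ProbabilityMeasure (Rd d) := fun n => (γs n).map (hm n).aemeasurable
  let ν : ProbabilityMeasure (Rd d) := (graphPlan μ T hT).map measurable_snd.aemeasurable
  have hν : (ν : Measure (Rd d)) = μ.map T := by
    change (μ.map fun x => (x, T x)).map Prod.snd = _
    rw [Measure.map_map (by fun_prop) (by fun_prop)]
    rfl
  suffices h : Tendsto η atTop (𝓝 ν) by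
    have h' := ProbabilityMeasure.tendsto_iff_forall_integral_tendsto.1 h f
    rw [hν, integral_map hT.aemeasurable f.continuous.aestronglyMeasurable] at h'
    refine h'.congr fun n => ?_
    exact integral_map (hm n).aemeasurable f.continuous.aestronglyMeasurable
  have hsnd : Tendsto (fun n => (γs n).map measurable_snd.aemeasurable) atTop (𝓝 ν) :=
    ProbabilityMeasure.tendsto_map_of_tendsto_of_continuous γs _ hlim continuous_snd
  rw [tendsto_iff_forall_lipschitz_integral_tendsto] at hsnd ⊢
  rintro f hfb ⟨K, hK⟩
  have hlimf := hsnd f hfb ⟨K, hK⟩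
  obtain ⟨B, hB⟩ := hfb
  have hfi : ∀ (m : Measure (Rd d × Rd d)) [IsProbabilityMeasure m] (g : Rd d × Rd d → Rd d),
      Measurable g → Integrable (fun z => f (g z)) m := by
    intro m _ g hg
    refine Integrable.of_bound (C := |f 0| + B)
      (hK.continuous.measurable.comp hg).aestronglyMeasurable (ae_of_all _ fun z => ?_)
    have h1 := hB (g z) 0
    rw [Real.dist_eq] at h1
    have h2 := abs_sub_abs_le_abs_sub (f (g z)) (f 0)
    rw [Real.norm_eq_abs]
    linarith
  have hdiff : Tendsto (fun n => ∫ x, f x ∂(η n : Measure (Rd d))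
      - ∫ x, f x ∂((γs n).map measurable_snd.aemeasurable : ProbabilityMeasure (Rd d))) atTop
      (𝓝 0) := by
    have hz := tendsto_lintegral_enorm_barycentricProjection_sub hT hTi hlim hC
    have hz' : Tendsto (fun n => (K : ℝ≥0∞) * ∫⁻ z, ‖barycentricProjection (γs n) z.1 - z.2‖ₑ
        ∂(γs n : Measure (Rd d × Rd d))) atTop (𝓝 0) := by
      simpa using ENNReal.Tendsto.const_mul hz (Or.inr ENNReal.coe_ne_top)
    rw [tendsto_zero_iff_enorm_tendsto_zero]
    refine tendsto_of_tendsto_of_tendsto_of_le_of_le tendsto_const_nhds hz'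
      (fun _ => zero_le) fun n => ?_
    change ‖∫ x, f x ∂((γs n : Measure (Rd d × Rd d)).map _)
      - ∫ x, f x ∂((γs n : Measure (Rd d × Rd d)).map _)‖ₑ ≤ _
    rw [integral_map (hm n).aemeasurable hK.continuous.aestronglyMeasurable,
      integral_map measurable_snd.aemeasurable hK.continuous.aestronglyMeasurable,
      ← integral_sub (hfi _ _ (hm n)) (hfi _ _ measurable_snd)]
    refine (enorm_integral_le_lintegral_enorm _).trans ?_
    rw [← lintegral_const_mul' _ _ ENNReal.coe_ne_top]
    refine lintegral_mono fun z => ?_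
    have := hK (barycentricProjection (γs n) z.1) z.2
    rwa [edist_eq_enorm_sub, edist_eq_enorm_sub] at this
  simpa using hdiff.add hlimf

end Barycentric

section Stability

variable {d : ℕ}

/-- Plans with uniformly bounded second moments form a relatively compact set. -/
lemma exists_isCompact_of_moment_le {C : ℝ} (hC : 0 ≤ C) :
    ∃ K : Set (ProbabilityMeasure (Rd d × Rd d)), IsCompact K ∧
      ∀ γ : ProbabilityMeasure (Rd d × Rd d),
        ∫⁻ z, ‖z.1‖ₑ ^ 2 ∂(γ : Measure (Rd d × Rd d)) ≤ ENNReal.ofReal C →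
        ∫⁻ z, ‖z.2‖ₑ ^ 2 ∂(γ : Measure (Rd d × Rd d)) ≤ ENNReal.ofReal C → γ ∈ K := by
  have hu : Tendsto (fun m : ℕ => Real.toNNReal (2 * C / ((m : ℝ) + 1))) atTop (𝓝 0) := by
    have h := (tendsto_const_nhds (x := 2 * C)).div_atTop
      (tendsto_natCast_atTop_atTop.atTop_add (tendsto_const_nhds (x := (1 : ℝ))))
    simpa [Function.comp_def] using (continuous_real_toNNReal.tendsto 0).comp h
  refine ⟨_, isCompact_setOfPred_probabilityMeasure_mass_eq_compl_isCompact_le hu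
    (fun m : ℕ => isCompact_closedBall (0 : Rd d × Rd d) ((m : ℝ) + 1)) (Or.inl inferInstance),
    fun γ h1 h2 m => ?_⟩
  rw [← ENNReal.coe_le_coe, ProbabilityMeasure.ennreal_coeFn_eq_coeFn_toMeasure]
  change _ ≤ ENNReal.ofReal _
  have hm : (0 : ℝ) < (m : ℝ) + 1 := by positivity
  have hsub : (Metric.closedBall (0 : Rd d × Rd d) ((m : ℝ) + 1))ᶜ
      ⊆ {z | ENNReal.ofReal ((m : ℝ) + 1) ≤ ‖z.1‖ₑ ^ 2 + ‖z.2‖ₑ ^ 2} := by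
    intro z hz
    have hz' : (m : ℝ) + 1 < ‖z‖ := by simpa using hz
    change ENNReal.ofReal _ ≤ _
    rw [← ofReal_norm, ← ofReal_norm, ← ENNReal.ofReal_pow (norm_nonneg _),
      ← ENNReal.ofReal_pow (norm_nonneg _), ← ENNReal.ofReal_add (by positivity) (by positivity)]
    refine ENNReal.ofReal_le_ofReal ?_
    rw [Prod.norm_def] at hz'
    have hm0 : (0 : ℝ) ≤ m := Nat.cast_nonneg m
    rcases lt_max_iff.1 hz' with h | h
    · nlinarith [sq_nonneg ‖z.2‖]
    · nlinarith [sq_nonneg ‖z.1‖]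
  refine (measure_mono hsub).trans ((meas_ge_le_lintegral_div (by fun_prop)
    (by simpa using hm) ENNReal.ofReal_ne_top).trans ?_)
  rw [ENNReal.ofReal_div_of_pos hm]
  refine ENNReal.div_le_div_right ?_ _
  rw [lintegral_add_left (by fun_prop), two_mul, ENNReal.ofReal_add hC hC]
  exact add_le_add h1 h2

lemma tendsto_charFun_of_tendsto {ι : Type*} {L : Filter ι} {μs : ι → ProbabilityMeasure (Rd d)}
    {μ : ProbabilityMeasure (Rd d)} (h : Tendsto μs L (𝓝 μ)) (t : Rd d) :
    Tendsto (fun n => charFun (μs n : Measure (Rd d)) t) L (𝓝 (charFun (μ : Measure (Rd d)) t)) := by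
  rw [ProbabilityMeasure.tendsto_iff_forall_integral_rclike_tendsto ℂ] at h
  simp_rw [charFun_eq_integral_innerProbChar]
  exact h (BoundedContinuousFunction.innerProbChar t)

/-- A weak limit is determined by the limits of the characteristic functions on a dense set. -/
lemma eq_of_tendsto_of_tendsto_charFun {ι : Type*} {L : Filter ι} [L.NeBot]
    {μs : ι → ProbabilityMeasure (Rd d)} {μ : ProbabilityMeasure (Rd d)}
    (h : Tendsto μs L (𝓝 μ)) {ν : Measure (Rd d)} [IsProbabilityMeasure ν] {D : Set (Rd d)}
    (hD : Dense D)
    (hν : ∀ t ∈ D, Tendsto (fun n => charFun (μs n : Measure (Rd d)) t) L (𝓝 (charFun ν t))) :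
    (μ : Measure (Rd d)) = ν := by
  refine Measure.ext_of_charFun (Continuous.ext_on hD (by fun_prop) (by fun_prop) fun t ht => ?_)
  exact tendsto_nhds_unique (tendsto_charFun_of_tendsto h t) (hν t ht)

/-- Stability of optimal transport: plans concentrated on cyclically monotone sets, with bounded
second moments and convergent marginals, converge to the plan induced by the Monge map. -/
theorem IsMongeMap.tendsto_graphPlan {μ ν : Measure (Rd d)} [IsProbabilityMeasure μ]
    [IsProbabilityMeasure ν] (hμ2 : MemLp id 2 μ) (hν2 : MemLp id 2 ν) (hac : μ ≪ volume)
    {T : Rd d → Rd d} (hT : IsMongeMap μ ν T) {γs : ℕ → ProbabilityMeasure (Rd d × Rd d)} {C : ℝ}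
    (h1 : ∀ᶠ n in atTop, ∫⁻ z, ‖z.1‖ₑ ^ 2 ∂(γs n : Measure (Rd d × Rd d)) ≤ ENNReal.ofReal C)
    (h2 : ∀ᶠ n in atTop, ∫⁻ z, ‖z.2‖ₑ ^ 2 ∂(γs n : Measure (Rd d × Rd d)) ≤ ENNReal.ofReal C)
    (hmono : ∀ᶠ n in atTop, ∃ A : Set (Rd d × Rd d), IsCyclicallyMonotone A ∧
      ∀ᵐ z ∂(γs n : Measure (Rd d × Rd d)), z ∈ A)
    {D : Set (Rd d)} (hD : Dense D)
    (hfst : ∀ t ∈ D, Tendsto (fun n => charFun ((γs n : Measure (Rd d × Rd d)).map Prod.fst) t)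
      atTop (𝓝 (charFun μ t)))
    (hsnd : ∀ t ∈ D, Tendsto (fun n => charFun ((γs n : Measure (Rd d × Rd d)).map Prod.snd) t)
      atTop (𝓝 (charFun ν t))) :
    Tendsto γs atTop (𝓝 (graphPlan μ T hT.1)) := by
  wlog hC : 0 ≤ C generalizing C
  · rw [ENNReal.ofReal_of_nonpos (not_le.1 hC).le] at h1 h2
    exact this (C := 0) (by simpa using h1) (by simpa using h2) le_rfl
  obtain ⟨K, hK, hKmem⟩ := exists_isCompact_of_moment_le (d := d) hC
  rw [tendsto_iff_ultrafilter]
  intro U hU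
  have hmem : K ∈ (U.map γs : Filter (ProbabilityMeasure (Rd d × Rd d))) := by
    rw [Ultrafilter.coe_map, mem_map]
    filter_upwards [hU h1, hU h2] with n hn1 hn2 using hKmem _ hn1 hn2
  obtain ⟨γ, -, hγ⟩ := hK.ultrafilter_le_nhds' _ hmem
  have hlim : Tendsto γs U (𝓝 γ) := hγ
  obtain ⟨A, hA⟩ : ∃ A : ℕ → Set (Rd d × Rd d), ∀ᶠ n in (U : Filter ℕ),
      IsCyclicallyMonotone (A n) ∧ ∀ᵐ z ∂(γs n : Measure (Rd d × Rd d)), z ∈ A n := by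
    have : ∀ n, ∃ A : Set (Rd d × Rd d), (∃ A : Set (Rd d × Rd d), IsCyclicallyMonotone A ∧
        ∀ᵐ z ∂(γs n : Measure (Rd d × Rd d)), z ∈ A) → IsCyclicallyMonotone A ∧
        ∀ᵐ z ∂(γs n : Measure (Rd d × Rd d)), z ∈ A := by
      intro n
      by_cases h : ∃ A : Set (Rd d × Rd d), IsCyclicallyMonotone A ∧
        ∀ᵐ z ∂(γs n : Measure (Rd d × Rd d)), z ∈ A
      · exact ⟨h.choose, fun _ => h.choose_spec⟩
      · exact ⟨∅, fun h' => absurd h' h⟩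
    choose A hA using this
    exact ⟨A, by filter_upwards [hU hmono] with n hn using hA n hn⟩
  have hsupp := isCyclicallyMonotone_support_of_tendsto hlim hA
  have hγfst : (γ : Measure (Rd d × Rd d)).map Prod.fst = μ :=
    eq_of_tendsto_of_tendsto_charFun
      (ProbabilityMeasure.tendsto_map_of_tendsto_of_continuous γs _ hlim continuous_fst) hD
      fun t ht => (hfst t ht).mono_left hU
  have hγsnd : (γ : Measure (Rd d × Rd d)).map Prod.snd = ν :=
    eq_of_tendsto_of_tendsto_charFun
      (ProbabilityMeasure.tendsto_map_of_tendsto_of_continuous γs _ hlim continuous_snd) hD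
      fun t ht => (hsnd t ht).mono_left hU
  have hgraph : γ = graphPlan μ T hT.1 := Subtype.ext
    (hT.eq_map_of_isCyclicallyMonotone hμ2 hν2 hac (γ : Measure (Rd d × Rd d)) hγfst hγsnd hsupp
      Measure.support_mem_ae)
  rwa [← hgraph]

end Stability

section Sampling

variable {d : ℕ}

lemma IsUnnormalizedDensity.absolutelyContinuous {p : Rd d → ℝ} {μ : Measure (Rd d)}
    (hp : IsUnnormalizedDensity p μ) : μ ≪ volume := by
  obtain ⟨-, -, Z, hZ, h⟩ := hp
  have h1 : ENNReal.ofReal Z • μ ≪ volume := h ▸ withDensity_absolutelyContinuous _ _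
  refine Measure.AbsolutelyContinuous.trans ?_ h1
  exact Measure.absolutelyContinuous_smul (by simpa using hZ)

lemma importanceWeight_nonneg {p q : Rd d → ℝ} {μ ν : Measure (Rd d)}
    (hp : IsUnnormalizedDensity p μ) (hq : IsUnnormalizedDensity q ν) (x : Rd d) :
    0 ≤ importanceWeight p q x :=
  div_nonneg (hq.2.1 x) (hp.2.1 x)

lemma measurable_importanceWeight {p q : Rd d → ℝ} {μ ν : Measure (Rd d)}
    (hp : IsUnnormalizedDensity p μ) (hq : IsUnnormalizedDensity q ν) :
    Measurable (importanceWeight p q) :=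
  hq.1.div hp.1

/-- The importance weight is a multiple of the density of `ν` with respect to `μ`. -/
lemma exists_withDensity_importanceWeight_eq {p q : Rd d → ℝ} {μ ν : Measure (Rd d)}
    (hp : IsUnnormalizedDensity p μ) (hq : IsUnnormalizedDensity q ν)
    (hpq : ∀ᵐ x ∂(volume : Measure (Rd d)), p x = 0 → q x = 0) :
    ∃ r : ℝ, 0 < r ∧
      μ.withDensity (fun x => ENNReal.ofReal (importanceWeight p q x)) = ENNReal.ofReal r • ν := by
  have hwm := measurable_importanceWeight hp hq
  obtain ⟨hpm, hp0, Z, hZ, hZp⟩ := hp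
  obtain ⟨hqm, hq0, Z', hZ', hZq⟩ := hq
  refine ⟨Z' / Z, by positivity, ?_⟩
  have hZne : ENNReal.ofReal Z ≠ 0 := by simpa using hZ
  have h : ENNReal.ofReal Z • μ.withDensity (fun x => ENNReal.ofReal (importanceWeight p q x))
      = ENNReal.ofReal Z' • ν := by
    rw [← withDensity_smul_measure, ← hZp, ← hZq,
      ← withDensity_mul _ hpm.ennreal_ofReal hwm.ennreal_ofReal]
    refine withDensity_congr_ae ?_
    filter_upwards [hpq] with x hx
    rw [Pi.mul_apply, ← ENNReal.ofReal_mul (hp0 x), importanceWeight]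
    by_cases h0 : p x = 0
    · simp [h0, hx h0]
    · rw [mul_div_cancel₀ _ h0]
  calc μ.withDensity (fun x => ENNReal.ofReal (importanceWeight p q x))
      = (ENNReal.ofReal Z)⁻¹ • (ENNReal.ofReal Z •
          μ.withDensity (fun x => ENNReal.ofReal (importanceWeight p q x))) := by
        rw [smul_smul, ENNReal.inv_mul_cancel hZne ENNReal.ofReal_ne_top, one_smul]
    _ = _ := by
        rw [h, smul_smul, ENNReal.ofReal_div_of_pos hZ, ENNReal.div_eq_inv_mul]

lemma integrable_importanceWeight_smul {F : Type*} [NormedAddCommGroup F] [NormedSpace ℝ F]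
    {w : Rd d → ℝ} {μ ν : Measure (Rd d)} (hw0 : ∀ x, 0 ≤ w x) (hwm : Measurable w) {r : ℝ}
    (hr : 0 < r) (h : μ.withDensity (fun x => ENNReal.ofReal (w x)) = ENNReal.ofReal r • ν)
    {f : Rd d → F} (hf : Integrable f ν) :
    Integrable (fun x => w x • f x) μ ∧ ∫ x, w x • f x ∂μ = r • ∫ x, f x ∂ν := by
  have hfin : ∀ᵐ x ∂μ, ENNReal.ofReal (w x) < ∞ := ae_of_all _ fun x => ENNReal.ofReal_lt_top
  have hi := hf.smul_measure (c := ENNReal.ofReal r) ENNReal.ofReal_ne_top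
  have he : ∫ x, f x ∂(ENNReal.ofReal r • ν) = r • ∫ x, f x ∂ν := by
    rw [integral_smul_measure, ENNReal.toReal_ofReal hr.le]
  rw [← h, integrable_withDensity_iff_integrable_smul' hwm.ennreal_ofReal hfin] at hi
  rw [← h, integral_withDensity_eq_integral_toReal_smul hwm.ennreal_ofReal hfin] at he
  simp_rw [ENNReal.toReal_ofReal (hw0 _)] at hi he
  exact ⟨hi, he⟩

/-- The strong law of large numbers for functions of an i.i.d. sequence. -/
lemma strong_law_ae_comp {F : Type*} [NormedAddCommGroup F] [NormedSpace ℝ F] [CompleteSpace F]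
    [MeasurableSpace F] [BorelSpace F] {μ : Measure (Rd d)}
    {Ω : Type*} [MeasurableSpace Ω] {P : Measure Ω} {X : ℕ → Ω → Rd d}
    (hX : ∀ i, HasLaw (X i) μ P) (hindep : iIndepFun X P) {f : Rd d → F} (hfm : Measurable f)
    (hf : Integrable f μ) :
    ∀ᵐ ω ∂P, Tendsto (fun n : ℕ => (n : ℝ)⁻¹ • ∑ i ∈ Finset.range n, f (X i ω)) atTop
      (𝓝 (∫ x, f x ∂μ)) := by
  have hint : Integrable (fun ω => f (X 0 ω)) P := by
    have := (hX 0).map_eq ▸ hf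
    exact (integrable_map_measure this.aestronglyMeasurable (hX 0).aemeasurable).1 this
  have heq : ∫ x, f x ∂μ = ∫ ω, f (X 0 ω) ∂P := by
    rw [← (hX 0).map_eq] at hf ⊢
    exact integral_map (hX 0).aemeasurable hf.aestronglyMeasurable
  rw [heq]
  refine strong_law_ae (fun i ω => f (X i ω)) hint
    (fun i j hij => (hindep.indepFun hij).comp hfm hfm) fun i => ?_
  have : IdentDistrib (X i) (X 0) P P :=
    ⟨(hX i).aemeasurable, (hX 0).aemeasurable, by rw [(hX i).map_eq, (hX 0).map_eq]⟩
  exact this.comp hfm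

/-- The empirical measure is concentrated on the sample points. -/
lemma ae_mem_image_empiricalMeasure (n : ℕ) (x : ℕ → Rd d) :
    ∀ᵐ y ∂(empiricalMeasure n x), y ∈ x '' (Finset.range n : Set ℕ) := by
  refine Measure.ae_smul_measure ?_ _
  rw [ae_iff, Measure.finsetSum_apply]
  refine Finset.sum_eq_zero fun i hi => ?_
  rw [Measure.dirac_apply, Set.indicator_of_notMem]
  exact fun h => h ⟨i, hi, rfl⟩

lemma ae_mem_image_importanceMeasure (p q : Rd d → ℝ) (n : ℕ) (x : ℕ → Rd d) :
    ∀ᵐ y ∂(importanceMeasure p q n x), y ∈ x '' (Finset.range n : Set ℕ) := by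
  rw [ae_iff, importanceMeasure, Measure.finsetSum_apply]
  refine Finset.sum_eq_zero fun i hi => ?_
  rw [Measure.smul_apply, Measure.dirac_apply, Set.indicator_of_notMem, smul_zero]
  exact fun h => h ⟨i, hi, rfl⟩

lemma integrable_empiricalMeasure {F : Type*} [NormedAddCommGroup F] {n : ℕ} (hn : n ≠ 0)
    (x : ℕ → Rd d) {f : Rd d → F} :
    Integrable f (empiricalMeasure n x) := by
  refine Integrable.smul_measure ?_ (by simpa using hn)
  exact integrable_finsetSum_measure.2 fun i _ => integrable_dirac (by simp)

lemma integral_empiricalMeasure {F : Type*} [NormedAddCommGroup F] [NormedSpace ℝ F]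
    [CompleteSpace F] (n : ℕ) (x : ℕ → Rd d) (f : Rd d → F) :
    ∫ y, f y ∂(empiricalMeasure n x) = (n : ℝ)⁻¹ • ∑ i ∈ Finset.range n, f (x i) := by
  rw [empiricalMeasure, integral_smul_measure,
    integral_finsetSum_measure fun i _ => integrable_dirac (by simp)]
  simp

lemma integrable_importanceMeasure {F : Type*} [NormedAddCommGroup F] (p q : Rd d → ℝ) (n : ℕ)
    (x : ℕ → Rd d) {f : Rd d → F} :
    Integrable f (importanceMeasure p q n x) :=
  integrable_finsetSum_measure.2 fun i _ =>
    (integrable_dirac (by simp)).smul_measure ENNReal.ofReal_ne_top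

lemma integral_importanceMeasure {F : Type*} [NormedAddCommGroup F] [NormedSpace ℝ F]
    [CompleteSpace F] {p q : Rd d → ℝ} (hw : ∀ x, 0 ≤ importanceWeight p q x) {n : ℕ}
    {x : ℕ → Rd d} (hn : n ≠ 0) (f : Rd d → F) :
    ∫ y, f y ∂(importanceMeasure p q n x) = ((n : ℝ)⁻¹ • totalWeight p q n x)⁻¹ •
      ((n : ℝ)⁻¹ • ∑ i ∈ Finset.range n, importanceWeight p q (x i) • f (x i)) := by
  have hW : 0 ≤ totalWeight p q n x := Finset.sum_nonneg fun i _ => hw _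
  rw [importanceMeasure, integral_finsetSum_measure fun i _ =>
    (integrable_dirac (by simp)).smul_measure ENNReal.ofReal_ne_top]
  simp_rw [integral_smul_measure, integral_dirac, ENNReal.toReal_ofReal (div_nonneg (hw _) hW)]
  rw [smul_smul, smul_eq_mul, Finset.smul_sum]
  refine Finset.sum_congr rfl fun i _ => ?_
  rw [smul_smul]
  congr 1
  have : (n : ℝ) ≠ 0 := by exact_mod_cast hn
  rw [mul_inv, inv_inv]
  field_simp

end Sampling

section Convergence

open scoped RealInnerProductSpace

variable {d : ℕ}

lemma lintegral_enorm_sq_eq_ofReal_integral {m : Measure (Rd d)}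
    (h : Integrable (fun y : Rd d => ‖y‖ ^ 2) m) :
    ∫⁻ y, ‖y‖ₑ ^ 2 ∂m = ENNReal.ofReal (∫ y, ‖y‖ ^ 2 ∂m) := by
  rw [ofReal_integral_eq_lintegral_ofReal h (ae_of_all _ fun y => by positivity)]
  refine lintegral_congr fun y => ?_
  rw [ENNReal.ofReal_pow (norm_nonneg _), ofReal_norm]

lemma eLpNorm_two_eq {m : Measure (Rd d)} (f : Rd d → Rd d) :
    eLpNorm f 2 m = (∫⁻ x, ‖f x‖ₑ ^ 2 ∂m) ^ (1 / 2 : ℝ) := by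
  rw [eLpNorm_eq_lintegral_rpow_enorm_toReal (by norm_num) (by norm_num)]
  simp

/-- The almost sure properties of a sample on which the conclusion rests. -/
structure IsGoodSample (μ ν : Measure (Rd d)) (p q : Rd d → ℝ) (x : ℕ → Rd d) : Prop where
  totalWeight_pos : ∀ᶠ n in atTop, 0 < totalWeight p q n x
  charFun_empirical : ∀ k : ℕ, Tendsto
    (fun n => charFun (empiricalMeasure n x) (TopologicalSpace.denseSeq (Rd d) k)) atTop
    (𝓝 (charFun μ (TopologicalSpace.denseSeq (Rd d) k)))
  charFun_importance : ∀ k : ℕ, Tendsto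
    (fun n => charFun (importanceMeasure p q n x) (TopologicalSpace.denseSeq (Rd d) k)) atTop
    (𝓝 (charFun ν (TopologicalSpace.denseSeq (Rd d) k)))
  moment_empirical : Tendsto (fun n => ∫ y, ‖y‖ ^ 2 ∂(empiricalMeasure n x)) atTop
    (𝓝 (∫ y, ‖y‖ ^ 2 ∂μ))
  moment_importance : Tendsto (fun n => ∫ y, ‖y‖ ^ 2 ∂(importanceMeasure p q n x)) atTop
    (𝓝 (∫ y, ‖y‖ ^ 2 ∂ν))

/-- Convergence of the plans and their barycentric projections along a good sample. -/
theorem IsGoodSample.tendsto {μ ν : Measure (Rd d)} [IsProbabilityMeasure μ]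
    [IsProbabilityMeasure ν] (hμ2 : MemLp id 2 μ) (hν2 : MemLp id 2 ν) (hac : μ ≪ volume)
    {T : Rd d → Rd d} (hT : IsMongeMap μ ν T) {p q : Rd d → ℝ} {x : ℕ → Rd d}
    (hx : IsGoodSample μ ν p q x) {γ : ℕ → ProbabilityMeasure (Rd d × Rd d)}
    (hγ : ∀ n, 0 < totalWeight p q n x →
      IsOptimalPlan (empiricalMeasure n x) (importanceMeasure p q n x) (γ n)) :
    WeaklyConverges (fun n => (empiricalMeasure n x).map (barycentricProjection (γ n)))
        (μ.map T) ∧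
      limsup (fun n => eLpNorm (barycentricProjection (γ n)) 2 (empiricalMeasure n x)) atTop
        ≤ eLpNorm T 2 μ := by
  have hopt : ∀ᶠ n in atTop,
      IsOptimalPlan (empiricalMeasure n x) (importanceMeasure p q n x) (γ n) :=
    hx.totalWeight_pos.mono hγ
  have hmom1 : ∀ᶠ n in atTop, ∫⁻ z, ‖z.1‖ₑ ^ 2 ∂(γ n : Measure (Rd d × Rd d))
      = ENNReal.ofReal (∫ y, ‖y‖ ^ 2 ∂(empiricalMeasure n x)) := by
    filter_upwards [hopt, eventually_ne_atTop 0] with n hn hn0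
    rw [← lintegral_enorm_sq_eq_ofReal_integral (integrable_empiricalMeasure hn0 x), ← hn.1.1,
      lintegral_map (by fun_prop) measurable_fst]
  have hmom2 : ∀ᶠ n in atTop, ∫⁻ z, ‖z.2‖ₑ ^ 2 ∂(γ n : Measure (Rd d × Rd d))
      = ENNReal.ofReal (∫ y, ‖y‖ ^ 2 ∂(importanceMeasure p q n x)) := by
    filter_upwards [hopt] with n hn
    rw [← lintegral_enorm_sq_eq_ofReal_integral (integrable_importanceMeasure p q n x), ← hn.1.2,
      lintegral_map (by fun_prop) measurable_snd]
  set C : ℝ := max (∫ y, ‖y‖ ^ 2 ∂μ) (∫ y, ‖y‖ ^ 2 ∂ν) + 1 with hC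
  have hC1 : ∀ᶠ n in atTop,
      ∫⁻ z, ‖z.1‖ₑ ^ 2 ∂(γ n : Measure (Rd d × Rd d)) ≤ ENNReal.ofReal C := by
    filter_upwards [hmom1, hx.moment_empirical.eventually (gt_mem_nhds
      (lt_of_le_of_lt (le_max_left _ _) (lt_add_one _) : _ < C))] with n h1 h2
    rw [h1]
    exact ENNReal.ofReal_le_ofReal h2.le
  have hC2 : ∀ᶠ n in atTop,
      ∫⁻ z, ‖z.2‖ₑ ^ 2 ∂(γ n : Measure (Rd d × Rd d)) ≤ ENNReal.ofReal C := by
    filter_upwards [hmom2, hx.moment_importance.eventually (gt_mem_nhds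
      (lt_of_le_of_lt (le_max_right _ _) (lt_add_one _) : _ < C))] with n h1 h2
    rw [h1]
    exact ENNReal.ofReal_le_ofReal h2.le
  have hmono : ∀ᶠ n in atTop, ∃ A : Set (Rd d × Rd d), IsCyclicallyMonotone A ∧
      ∀ᵐ z ∂(γ n : Measure (Rd d × Rd d)), z ∈ A := by
    filter_upwards [hopt] with n hn
    set S : Set (Rd d) := x '' (Finset.range n : Set ℕ) with hS
    have hSf : S.Finite := (Finset.finite_toSet _).image x
    have h1 : ∀ᵐ z ∂(γ n : Measure (Rd d × Rd d)), z.1 ∈ S :=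
      ae_of_ae_map (p := fun y => y ∈ S) measurable_fst.aemeasurable
        (hn.1.1.symm ▸ ae_mem_image_empiricalMeasure n x)
    have h2 : ∀ᵐ z ∂(γ n : Measure (Rd d × Rd d)), z.2 ∈ S :=
      ae_of_ae_map (p := fun y => y ∈ S) measurable_snd.aemeasurable
        (hn.1.2.symm ▸ ae_mem_image_importanceMeasure p q n x)
    have h12 : ∀ᵐ z ∂(γ n : Measure (Rd d × Rd d)), z ∈ S ×ˢ S := by
      filter_upwards [h1, h2] with z hz1 hz2 using ⟨hz1, hz2⟩
    exact ⟨_, hn.isCyclicallyMonotone_atoms (quadraticCost_ne_top_of_finite (hSf.prod hSf) h12),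
      ae_mem_atoms_of_finite (hSf.prod hSf) h12⟩
  have hlim : Tendsto γ atTop (𝓝 (graphPlan μ T hT.1)) := by
    refine hT.tendsto_graphPlan hμ2 hν2 hac hC1 hC2 hmono
      (TopologicalSpace.denseRange_denseSeq (Rd d)) ?_ ?_
    · rintro _ ⟨k, rfl⟩
      refine (hx.charFun_empirical k).congr' ?_
      filter_upwards [hopt] with n hn
      rw [hn.1.1]
    · rintro _ ⟨k, rfl⟩
      refine (hx.charFun_importance k).congr' ?_
      filter_upwards [hopt] with n hn
      rw [hn.1.2]
  have hT2 := memLp_of_map_eq hT.1 hT.2.1 hν2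
  refine ⟨fun f => ?_, ?_⟩
  · rw [integral_map hT.1.aemeasurable f.continuous.aestronglyMeasurable]
    refine (tendsto_map_barycentricProjection hT.1 (hT2.integrable (by norm_num)) hlim hC2
      f).congr' ?_
    filter_upwards [hopt] with n hn
    have hb := measurable_barycentricProjection (γ n)
    rw [integral_map hb.aemeasurable f.continuous.aestronglyMeasurable, ← hn.1.1]
    exact (integral_map (f := fun y => f (barycentricProjection (γ n) y))
      measurable_fst.aemeasurable (f.continuous.measurable.comp hb).aestronglyMeasurable).symm
  · have hle : ∀ᶠ n in atTop,
        eLpNorm (barycentricProjection (γ n)) 2 (empiricalMeasure n x)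
          ≤ ENNReal.ofReal (∫ y, ‖y‖ ^ 2 ∂(importanceMeasure p q n x)) ^ (1 / 2 : ℝ) := by
      filter_upwards [hopt, hmom2] with n hn hn2
      rw [eLpNorm_two_eq, ← hn2, ← hn.1.1]
      exact ENNReal.rpow_le_rpow (lintegral_enorm_sq_barycentricProjection_le (γ n)) (by norm_num)
    have hTlim : Tendsto
        (fun n => ENNReal.ofReal (∫ y, ‖y‖ ^ 2 ∂(importanceMeasure p q n x)) ^ (1 / 2 : ℝ)) atTop
        (𝓝 (eLpNorm T 2 μ)) := by
      rw [eLpNorm_two_eq, lintegral_enorm_sq_eq hT2,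
        integral_norm_sq_eq_of_map_eq hT.1 hT.2.1]
      exact ((ENNReal.continuous_rpow_const).tendsto _).comp
        ((ENNReal.continuous_ofReal.tendsto _).comp hx.moment_importance)
    exact (limsup_le_limsup hle).trans hTlim.limsup_eq.le

/-- The self-normalized importance sampling estimator is strongly consistent. -/
lemma ae_tendsto_integral_importanceMeasure {F : Type*} [NormedAddCommGroup F] [NormedSpace ℝ F]
    [CompleteSpace F] [MeasurableSpace F] [BorelSpace F] [SecondCountableTopology F]
    {μ ν : Measure (Rd d)} [IsProbabilityMeasure ν] {p q : Rd d → ℝ}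
    (hp : IsUnnormalizedDensity p μ) (hq : IsUnnormalizedDensity q ν)
    (hpq : ∀ᵐ x ∂(volume : Measure (Rd d)), p x = 0 → q x = 0)
    {Ω : Type*} [MeasurableSpace Ω] {P : Measure Ω} {X : ℕ → Ω → Rd d}
    (hX : ∀ i, HasLaw (X i) μ P) (hindep : iIndepFun X P) {f : Rd d → F} (hfm : Measurable f)
    (hf : Integrable f ν) :
    ∀ᵐ ω ∂P, Tendsto (fun n => ∫ y, f y ∂(importanceMeasure p q n (fun i => X i ω))) atTop
      (𝓝 (∫ y, f y ∂ν)) ∧ ∀ᶠ n in atTop, 0 < totalWeight p q n (fun i => X i ω) := by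
  obtain ⟨r, hr, hdens⟩ := exists_withDensity_importanceWeight_eq hp hq hpq
  have hw0 := importanceWeight_nonneg hp hq
  have hwm := measurable_importanceWeight hp hq
  obtain ⟨hi, he⟩ := integrable_importanceWeight_smul hw0 hwm hr hdens hf
  obtain ⟨hi1, he1⟩ := integrable_importanceWeight_smul hw0 hwm hr hdens
    (integrable_const (1 : ℝ) : Integrable (fun _ : Rd d => (1 : ℝ)) ν)
  simp only [smul_eq_mul, mul_one, integral_const, probReal_univ] at hi1 he1
  filter_upwards [strong_law_ae_comp hX hindep (hwm.smul hfm) hi,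
    strong_law_ae_comp hX hindep hwm hi1] with ω h1 h2
  simp only [Pi.smul_apply', he] at h1
  rw [he1] at h2
  constructor
  · have h := (h2.inv₀ hr.ne').smul h1
    rw [smul_smul, inv_mul_cancel₀ hr.ne', one_smul] at h
    refine h.congr' ?_
    filter_upwards [eventually_ne_atTop 0] with n hn
    rw [integral_importanceMeasure hw0 hn]
    rfl
  · filter_upwards [h2.eventually (lt_mem_nhds hr)] with n hn
    by_contra hneg
    refine absurd hn (not_lt.2 ?_)
    exact mul_nonpos_of_nonneg_of_nonpos (by positivity) (not_lt.1 hneg)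

lemma ae_tendsto_integral_empiricalMeasure {F : Type*} [NormedAddCommGroup F] [NormedSpace ℝ F]
    [CompleteSpace F] [MeasurableSpace F] [BorelSpace F]
    {μ : Measure (Rd d)} {Ω : Type*} [MeasurableSpace Ω] {P : Measure Ω} {X : ℕ → Ω → Rd d}
    (hX : ∀ i, HasLaw (X i) μ P) (hindep : iIndepFun X P) {f : Rd d → F} (hfm : Measurable f)
    (hf : Integrable f μ) :
    ∀ᵐ ω ∂P, Tendsto (fun n => ∫ y, f y ∂(empiricalMeasure n (fun i => X i ω))) atTop
      (𝓝 (∫ y, f y ∂μ)) := by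
  filter_upwards [strong_law_ae_comp hX hindep hfm hf] with ω h
  simpa only [integral_empiricalMeasure] using h

/-- Almost every sample is good. -/
theorem ae_isGoodSample {μ ν : Measure (Rd d)} [IsProbabilityMeasure μ] [IsProbabilityMeasure ν]
    (hμ2 : MemLp id 2 μ) (hν2 : MemLp id 2 ν) {p q : Rd d → ℝ}
    (hp : IsUnnormalizedDensity p μ) (hq : IsUnnormalizedDensity q ν)
    (hpq : ∀ᵐ x ∂(volume : Measure (Rd d)), p x = 0 → q x = 0)
    {Ω : Type*} [MeasurableSpace Ω] {P : Measure Ω} {X : ℕ → Ω → Rd d}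
    (hX : ∀ i, HasLaw (X i) μ P) (hindep : iIndepFun X P) :
    ∀ᵐ ω ∂P, IsGoodSample μ ν p q (fun i => X i ω) := by
  have hexpm : ∀ t : Rd d, Measurable fun y : Rd d => Complex.exp (⟪y, t⟫ * Complex.I) :=
    fun t => by fun_prop
  have hexpi : ∀ (m : Measure (Rd d)) [IsProbabilityMeasure m] (t : Rd d),
      Integrable (fun y : Rd d => Complex.exp (⟪y, t⟫ * Complex.I)) m := fun m _ t =>
    Integrable.of_bound (C := 1) (hexpm t).aestronglyMeasurable
      (ae_of_all _ fun y => (Complex.norm_exp_ofReal_mul_I _).le)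
  have h1 := ae_all_iff.2 fun k : ℕ => ae_tendsto_integral_empiricalMeasure hX hindep
    (hexpm (TopologicalSpace.denseSeq (Rd d) k)) (hexpi μ _)
  have h2 := ae_all_iff.2 fun k : ℕ => ae_tendsto_integral_importanceMeasure hp hq hpq hX hindep
    (hexpm (TopologicalSpace.denseSeq (Rd d) k)) (hexpi ν _)
  have h3 := ae_tendsto_integral_empiricalMeasure hX hindep
    (f := fun y : Rd d => ‖y‖ ^ 2) (by fun_prop) (hμ2.integrable_norm_pow (by norm_num))
  have h4 := ae_tendsto_integral_importanceMeasure hp hq hpq hX hindep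
    (f := fun y : Rd d => ‖y‖ ^ 2) (by fun_prop) (hν2.integrable_norm_pow (by norm_num))
  filter_upwards [h1, h2, h3, h4] with ω h1 h2 h3 h4
  exact ⟨h4.2, h1, fun k => (h2 k).1, h3, h4.1⟩

end Convergence

end ImportanceTransport

theorem mainTheorem2 {d : ℕ}
    (μ ν : Measure (ImportanceTransport.Rd d)) [IsProbabilityMeasure μ] [IsProbabilityMeasure ν]
    (hμ2 : MemLp id 2 μ) (hν2 : MemLp id 2 ν)
    (p q : ImportanceTransport.Rd d → ℝ)
    (hp : ImportanceTransport.IsUnnormalizedDensity p μ)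
    (hq : ImportanceTransport.IsUnnormalizedDensity q ν)
    (hpq : ∀ᵐ x ∂(volume : Measure (ImportanceTransport.Rd d)), p x = 0 → q x = 0)
    (T : ImportanceTransport.Rd d → ImportanceTransport.Rd d)
    (hT : ImportanceTransport.IsMongeMap μ ν T)
    {Ω : Type*} [MeasurableSpace Ω] (P : Measure Ω) [IsProbabilityMeasure P]
    (X : ℕ → Ω → ImportanceTransport.Rd d)
    (hX : ∀ i, HasLaw (X i) μ P) (hindep : iIndepFun X P) :
    μ.map T = ν ∧
    ∀ᵐ ω ∂P,
      ∀ γ : ℕ → ProbabilityMeasure (ImportanceTransport.Rd d × ImportanceTransport.Rd d),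
        (∀ n, 0 < ImportanceTransport.totalWeight p q n (fun i => X i ω) →
          ImportanceTransport.IsOptimalPlan
            (ImportanceTransport.empiricalMeasure n (fun i => X i ω))
            (ImportanceTransport.importanceMeasure p q n (fun i => X i ω)) (γ n)) →
        ImportanceTransport.WeaklyConverges
            (fun n => (ImportanceTransport.empiricalMeasure n (fun i => X i ω)).map
              (ImportanceTransport.barycentricProjection (γ n)))
            (μ.map T) ∧
          limsup (fun n => eLpNorm (ImportanceTransport.barycentricProjection (γ n)) 2
              (ImportanceTransport.empiricalMeasure n (fun i => X i ω))) atTop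
            ≤ eLpNorm T 2 μ := by
  refine ⟨hT.2.1, ?_⟩
  filter_upwards [ImportanceTransport.ae_isGoodSample hμ2 hν2 hp hq hpq hX hindep] with ω hω γ hγ
  exact hω.tendsto hμ2 hν2 hp.absolutelyContinuous hT hγ
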